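/- **Setting.** Let $0<q<1$ and $n\in\mathbb N=\{0,1,2,\dots\}$. Let $\mathcal A(S^{2n+1}_q)$ be the unital complex $*$-algebra generated by $z_i,z_i^*$ ($0\le i\le n$) with relations $$z_iz_j=q^{-1}z_jz_i\ (i<j),\qquad z_i^*z_j=q\,z_jz_i^*\ (i\ne j),\qquad [z_i^*,z_i]=(1-q^2)\sum_{j>i}z_jz_j^*,\qquad \sum_{i=0}^n z_iz_i^*=1,$$ and let $\mathcal A(\mathbb{C}\mathrm P^n_q)$ be its $*$-subalgebra generated by the elements $z_i^*z_j$. For $k\le n$, elements of $\mathcal A(S^{2n+1}_q)$ are mapped to $\mathcal A(S^{2k+1}_q)$ by the $*$-algebra morphism $z_i\mapsto z_i$ $(i\le k)$, $z_i\mapsto 0$ $(i>k)$. **Representations.** For $k\in\mathbb N$ let $\mathcal H_k=\ell^2(\mathbb N^k)$ with orthonormal basis $|\underline m\rangle$, $\underline m=(m_1,\dots,m_k)$, and $m_0:=0$. For $0\le j\le k$ let $\pi^{(k)}_j:\mathcal A(S^{2k+1}_q)\to\mathcal B(\mathcal H_k)$ be the (in general non-unital) $*$-representation that vanishes on the orthogonal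 complement of the closed span $\overline{\mathcal V}{}^k_j$ of the vectors $|\underline m\rangle$ with $$0\le m_1\le\dots\le m_j,\qquad m_{j+1}>\dots>m_k\ge 0,$$ is unital on $\overline{\mathcal V}{}^k_j$, and on these basis vectors is given by $$\pi^{(k)}_j(z_i)|\underline m\rangle=q^{m_i}\sqrt{1-q^{2(m_{i+1}-m_i+1)}}\;|\underline m+\underline\varepsilon_i^j\rangle\ (0\le i<j),\qquad \pi^{(k)}_j(z_j)|\underline m\rangle=q^{m_j}|\underline m\rangle,\qquad \pi^{(k)}_j(z_i)|\underline m\rangle=0\ (i>j),$$ where $\underline\varepsilon_i^j$ has entries $1$ in the places $i+1,\dots,j$ and $0$ elsewhere. Put $\pi^{(k)}_+=\sum_{j\text{ even}}\pi^{(k)}_j$ and $\pi^{(k)}_-=\sum_{j\text{ odd}}\pi^{(k)}_j$ (sums over $0\le j\le k$); for $k\le n$ they are also regarded as representations of $\mathcal A(\mathbb{C}\mathrm P^n_q)$ through the morphism above. They define the $k$-th Fredholm module, with class $[\mu_k]$, on $\mathcal H_k\oplus\mathcal H_k$ (with the representation $\pi_+^{(k)}\oplus\pi_-^{(k)}$,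 the obvious grading and $F=\begin{pmatrix}0&1\\1&0\end{pmatrix}$). **Projections.** With $[m]=\frac{q^m-q^{-m}}{q-q^{-1}}$, $[m]!=[m][m-1]\cdots[1]$, $[0]!=1$ and $[j_0,\dots,j_n]!=\frac{[j_0+\dots+j_n]!}{[j_0]!\cdots[j_n]!}$, let $\Psi_{-N}$, for $N\in\mathbb N$, be the column vector with components $$\psi^{-N}_{j_0,\dots,j_n}=\bigl([j_0,\dots,j_n]!\bigr)^{1/2}\,q^{\frac12\sum_{r<s}j_rj_s+\sum_r r j_r}\,z_0^{j_0}\cdots z_n^{j_n},\qquad j_0+\dots+j_n=N,$$ and let $P_{-N}=\Psi_{-N}\Psi_{-N}^\dagger$, a square matrix with entries in $\mathcal A(\mathbb{C}\mathrm P^n_q)$. **Proposition.** For all $N\in\mathbb N$ and all $0\le k\le n$, the matrix $P_{-N}$ is a projection ($P_{-N}^2=P_{-N}=P_{-N}^\dagger$), the operator $(\pi_+^{(k)}-\pi_-^{(k)})(\mathrm{Tr}\,P_{-N})$ is of trace class on $\mathcal H_k$, and $$\langle[\mu_k],[P_{-N}]\rangle:=\mathrm{Tr}_{\mathcal H_k}\bigl(\pi_+^{(k)}-\pi_-^{(k)}\bigr)(\mathrm{Tr}\,P_{-N})=\binom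 Nk,$$ where $\binom Nk:=0$ for $k>N$. -/

import Mathlib

noncomputable section

namespace QuantumProjective

/-! ### The coordinate algebra of the quantum sphere `S_q^{2n+1}` -/

/-- The defining relations of the quantum sphere `S_q^{2n+1}` for elements `z i` and
`zs i` (which plays the role of `(z i)^*`) of a complex algebra. The field `comm_star` is the
adjoint of `comm`; the other relations are closed under taking adjoints. -/
structure SphereRelations {B : Type*} [Ring B] [Algebra ℂ B] (q : ℝ) {n : ℕ}
    (z zs : Fin (n + 1) → B) : Prop where
  comm : ∀ i j, i < j → z i * z j = ((q⁻¹ : ℝ) : ℂ) • (z j * z i)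
  comm_star : ∀ i j, i < j → zs j * zs i = ((q⁻¹ : ℝ) : ℂ) • (zs i * zs j)
  mixed : ∀ i j, i ≠ j → zs i * z j = (q : ℂ) • (z j * zs i)
  self : ∀ i, zs i * z i - z i * zs i =
    ((1 - q ^ 2 : ℝ) : ℂ) • ∑ j ∈ Finset.Ioi i, z j * zs j
  sphere : ∑ i, z i * zs i = 1

/-- The free algebra on the `2n+2` symbols `z_i` (`Sum.inl i`) and `z_i^*` (`Sum.inr i`). -/
abbrev FreeAlg (n : ℕ) : Type := FreeAlgebra ℂ (Fin (n + 1) ⊕ Fin (n + 1))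

/-- The symbol `z_i`. -/
abbrev fz {n : ℕ} (i : Fin (n + 1)) : FreeAlg n := FreeAlgebra.ι ℂ (Sum.inl i)

/-- The symbol `z_i^*`. -/
abbrev fzs {n : ℕ} (i : Fin (n + 1)) : FreeAlg n := FreeAlgebra.ι ℂ (Sum.inr i)

/-- The relations imposed on the free algebra. -/
inductive SphereRel (q : ℝ) (n : ℕ) : FreeAlg n → FreeAlg n → Prop
  | comm (i j : Fin (n + 1)) (h : i < j) :
      SphereRel q n (fz i * fz j) (((q⁻¹ : ℝ) : ℂ) • (fz j * fz i))
  | comm_star (i j : Fin (n + 1)) (h : i < j) :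
      SphereRel q n (fzs j * fzs i) (((q⁻¹ : ℝ) : ℂ) • (fzs i * fzs j))
  | mixed (i j : Fin (n + 1)) (h : i ≠ j) :
      SphereRel q n (fzs i * fz j) ((q : ℂ) • (fz j * fzs i))
  | self (i : Fin (n + 1)) :
      SphereRel q n (fzs i * fz i - fz i * fzs i)
        (((1 - q ^ 2 : ℝ) : ℂ) • ∑ j ∈ Finset.Ioi i, fz j * fzs j)
  | sphere : SphereRel q n (∑ i, fz i * fzs i) 1

/-- The coordinate algebra `A(S_q^{2n+1})`: the universal complex algebra generated by
`z_i, z_i^*`, `i = 0, …, n`, subject to the relations of the quantum sphere. -/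
def SphereAlg (q : ℝ) (n : ℕ) : Type := RingQuot (SphereRel q n)

instance (q : ℝ) (n : ℕ) : Ring (SphereAlg q n) := inferInstanceAs (Ring (RingQuot _))

instance (q : ℝ) (n : ℕ) : Algebra ℂ (SphereAlg q n) :=
  inferInstanceAs (Algebra ℂ (RingQuot _))

/-- The generator `z_i` of `A(S_q^{2n+1})`. -/
def zgen (q : ℝ) {n : ℕ} (i : Fin (n + 1)) : SphereAlg q n :=
  RingQuot.mkAlgHom ℂ (SphereRel q n) (fz i)

/-- The generator `z_i^*` of `A(S_q^{2n+1})`. -/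
def zsgen (q : ℝ) {n : ℕ} (i : Fin (n + 1)) : SphereAlg q n :=
  RingQuot.mkAlgHom ℂ (SphereRel q n) (fzs i)

theorem sphereRelations_gen (q : ℝ) (n : ℕ) :
    SphereRelations q (zgen q : Fin (n + 1) → SphereAlg q n) (zsgen q) where
  comm i j h := by
    have := RingQuot.mkAlgHom_rel ℂ (SphereRel.comm (q := q) i j h)
    rw [map_smul, map_mul, map_mul] at this
    exact this
  comm_star i j h := by
    have := RingQuot.mkAlgHom_rel ℂ (SphereRel.comm_star (q := q) i j h)
    rw [map_smul, map_mul, map_mul] at this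
    exact this
  mixed i j h := by
    have := RingQuot.mkAlgHom_rel ℂ (SphereRel.mixed (q := q) i j h)
    rw [map_smul, map_mul, map_mul] at this
    exact this
  self i := by
    have := RingQuot.mkAlgHom_rel ℂ (SphereRel.self (q := q) i)
    rw [map_smul, map_sub, map_mul, map_mul, map_sum] at this
    simp only [map_mul] at this
    exact this
  sphere := by
    have := RingQuot.mkAlgHom_rel ℂ (SphereRel.sphere (q := q) (n := n))
    rw [map_sum, map_one] at this
    simp only [map_mul] at this
    exact this

/-- The universal property of `A(S_q^{2n+1})` as an algebra. -/
def liftAlg {B : Type*} [Ring B] [Algebra ℂ B] {q : ℝ} {n : ℕ} {z zs : Fin (n + 1) → B}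
    (h : SphereRelations q z zs) : SphereAlg q n →ₐ[ℂ] B :=
  RingQuot.liftAlgHom ℂ ⟨FreeAlgebra.lift ℂ (Sum.elim z zs), by
    intro x y hxy
    induction hxy with
    | comm i j hij => simpa using h.comm i j hij
    | comm_star i j hij => simpa using h.comm_star i j hij
    | mixed i j hij =>
      rw [map_smul, map_mul, map_mul]
      simpa using h.mixed i j hij
    | self i => simpa using h.self i
    | sphere => simpa using h.sphere⟩

theorem liftAlg_z {B : Type*} [Ring B] [Algebra ℂ B] {q : ℝ} {n : ℕ} {z zs : Fin (n + 1) → B}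
    (h : SphereRelations q z zs) (i : Fin (n + 1)) : liftAlg h (zgen q i) = z i :=
  (RingQuot.liftAlgHom_mkAlgHom_apply ..).trans (by simp)

theorem liftAlg_zs {B : Type*} [Ring B] [Algebra ℂ B] {q : ℝ} {n : ℕ} {z zs : Fin (n + 1) → B}
    (h : SphereRelations q z zs) (i : Fin (n + 1)) : liftAlg h (zsgen q i) = zs i :=
  (RingQuot.liftAlgHom_mkAlgHom_apply ..).trans (by simp)

/-- Every element of `A(S_q^{2n+1})` is a polynomial in the generators. -/
theorem sphereAlg_induction {q : ℝ} {n : ℕ} {C : SphereAlg q n → Prop}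
    (hc : ∀ c : ℂ, C (algebraMap ℂ _ c)) (hz : ∀ i, C (zgen q i)) (hzs : ∀ i, C (zsgen q i))
    (hadd : ∀ a b, C a → C b → C (a + b)) (hmul : ∀ a b, C a → C b → C (a * b))
    (a : SphereAlg q n) : C a := by
  obtain ⟨x, rfl⟩ := RingQuot.mkAlgHom_surjective ℂ (SphereRel q n) a
  induction x using FreeAlgebra.induction with
  | grade0 c => rw [AlgHom.commutes]; exact hc c
  | grade1 i => rcases i with i | i
                · exact hz i
                · exact hzs i
  | mul a b ha hb => rw [map_mul]; exact hmul _ _ ha hb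
  | add a b ha hb => rw [map_add]; exact hadd _ _ ha hb

/-- The opposite algebra with complex conjugate scalar multiplication. -/
def ConjOp (A : Type*) : Type _ := Aᵐᵒᵖ

instance (A : Type*) [Ring A] : Ring (ConjOp A) := inferInstanceAs (Ring Aᵐᵒᵖ)

instance (A : Type*) [Ring A] [Algebra ℂ A] : Algebra ℂ (ConjOp A) where
  smul c x := (show Aᵐᵒᵖ from ((starRingEnd ℂ c) • (show Aᵐᵒᵖ from x)))
  algebraMap := (algebraMap ℂ Aᵐᵒᵖ).comp (starRingEnd ℂ)
  commutes' c x := Algebra.commutes (A := Aᵐᵒᵖ) (starRingEnd ℂ c) x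
  smul_def' c x := Algebra.smul_def (A := Aᵐᵒᵖ) (starRingEnd ℂ c) x

/-- The canonical map of `A` to `ConjOp A`. -/
def cop {A : Type*} (a : A) : ConjOp A := MulOpposite.op a

/-- The canonical map of `ConjOp A` to `A`. -/
def uncop {A : Type*} (a : ConjOp A) : A := MulOpposite.unop a

theorem cop_mul {A : Type*} [Ring A] (a b : A) : cop a * cop b = cop (b * a) := rfl

theorem smul_cop {A : Type*} [Ring A] [Algebra ℂ A] (c : ℂ) (a : A) :
    c • cop a = cop ((starRingEnd ℂ c) • a) := rfl

theorem cop_sub {A : Type*} [Ring A] (a b : A) : cop a - cop b = cop (a - b) := rfl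

theorem cop_sum {A ι : Type*} [Ring A] (s : Finset ι) (f : ι → A) :
    ∑ i ∈ s, cop (f i) = cop (∑ i ∈ s, f i) :=
  (map_sum (MulOpposite.opAddEquiv (α := A)) f s).symm

theorem sphereRelations_conjOp (q : ℝ) (n : ℕ) :
    SphereRelations q (fun i : Fin (n + 1) => cop (zsgen q i : SphereAlg q n))
      (fun i => cop (zgen q i)) where
  comm i j h := by
    rw [cop_mul, cop_mul, smul_cop, Complex.conj_ofReal,
      (sphereRelations_gen q n).comm_star i j h]
  comm_star i j h := by
    rw [cop_mul, cop_mul, smul_cop, Complex.conj_ofReal,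
      (sphereRelations_gen q n).comm i j h]
  mixed i j h := by
    rw [cop_mul, cop_mul, smul_cop, Complex.conj_ofReal,
      (sphereRelations_gen q n).mixed j i h.symm]
  self i := by
    simp only [cop_mul, cop_sub, cop_sum, smul_cop, Complex.conj_ofReal]
    rw [(sphereRelations_gen q n).self i]
  sphere := by
    simp only [cop_mul, cop_sum]
    rw [(sphereRelations_gen q n).sphere]
    rfl

/-- The involution of `A(S_q^{2n+1})` as a map to the conjugate opposite algebra. -/
def starHom (q : ℝ) (n : ℕ) : SphereAlg q n →ₐ[ℂ] ConjOp (SphereAlg q n) :=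
  liftAlg (sphereRelations_conjOp q n)

instance (q : ℝ) (n : ℕ) : Star (SphereAlg q n) := ⟨fun a => uncop (starHom q n a)⟩

theorem star_zgen (q : ℝ) {n : ℕ} (i : Fin (n + 1)) :
    star (zgen q i : SphereAlg q n) = zsgen q i :=
  congrArg uncop (liftAlg_z (sphereRelations_conjOp q n) i)

theorem star_zsgen (q : ℝ) {n : ℕ} (i : Fin (n + 1)) :
    star (zsgen q i : SphereAlg q n) = zgen q i :=
  congrArg uncop (liftAlg_zs (sphereRelations_conjOp q n) i)

theorem sphere_star_mul {q : ℝ} {n : ℕ} (a b : SphereAlg q n) :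
    star (a * b) = star b * star a :=
  congrArg uncop (map_mul (starHom q n) a b)

theorem sphere_star_add {q : ℝ} {n : ℕ} (a b : SphereAlg q n) :
    star (a + b) = star a + star b :=
  congrArg uncop (map_add (starHom q n) a b)

theorem sphere_star_algebraMap {q : ℝ} {n : ℕ} (c : ℂ) :
    star (algebraMap ℂ (SphereAlg q n) c) = algebraMap ℂ _ (starRingEnd ℂ c) :=
  congrArg uncop ((starHom q n).commutes c)

/-- `A(S_q^{2n+1})` is a *-algebra, with `(z_i)^* = zsgen q i`. -/
instance (q : ℝ) (n : ℕ) : StarRing (SphereAlg q n) where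
  star_involutive a := by
    induction a using sphereAlg_induction with
    | hc c => simp [sphere_star_algebraMap]
    | hz i => rw [star_zgen, star_zsgen]
    | hzs i => rw [star_zsgen, star_zgen]
    | hadd a b ha hb => rw [sphere_star_add, sphere_star_add, ha, hb]
    | hmul a b ha hb => rw [sphere_star_mul, sphere_star_mul, ha, hb]
  star_mul := sphere_star_mul
  star_add := sphere_star_add

instance (q : ℝ) (n : ℕ) : StarModule ℂ (SphereAlg q n) where
  star_smul c a := by
    rw [Algebra.smul_def, star_mul, sphere_star_algebraMap, ← Algebra.commutes,
      ← Algebra.smul_def]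
    rfl

/-- The universal property of `A(S_q^{2n+1})` as a *-algebra. -/
def liftStar {B : Type*} [Ring B] [Algebra ℂ B] [StarRing B] [StarModule ℂ B] {q : ℝ} {n : ℕ}
    {z : Fin (n + 1) → B} (h : SphereRelations q z (fun i => star (z i))) :
    SphereAlg q n →⋆ₐ[ℂ] B :=
  { liftAlg h with
    map_star' := by
      intro a
      change liftAlg h (star a) = star (liftAlg h a)
      induction a using sphereAlg_induction with
      | hc c =>
        rw [sphere_star_algebraMap, AlgHom.commutes, AlgHom.commutes]
        exact algebraMap_star_comm c
      | hz i => rw [star_zgen, liftAlg_z, liftAlg_zs]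
      | hzs i => rw [star_zsgen, liftAlg_z, liftAlg_zs, star_star]
      | hadd a b ha hb => rw [star_add, map_add, map_add, star_add, ha, hb]
      | hmul a b ha hb => rw [star_mul, map_mul, map_mul, star_mul, ha, hb] }

theorem liftStar_z {B : Type*} [Ring B] [Algebra ℂ B] [StarRing B] [StarModule ℂ B] {q : ℝ}
    {n : ℕ} {z : Fin (n + 1) → B} (h : SphereRelations q z (fun i => star (z i)))
    (i : Fin (n + 1)) : liftStar h (zgen q i) = z i :=
  liftAlg_z h i

/-! ### The quantum projective space and its restriction maps -/

/-- `A(CP_q^n)`: the *-subalgebra of `A(S_q^{2n+1})` generated by `p_{ij} = z_i^* z_j`. -/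
def projAlg (q : ℝ) (n : ℕ) : StarSubalgebra ℂ (SphereAlg q n) :=
  StarAlgebra.adjoin ℂ
    (Set.range fun ij : Fin (n + 1) × Fin (n + 1) => star (zgen q ij.1) * zgen q ij.2)

theorem sum_fin_Ioi {M : Type*} [AddCommMonoid M] {n : ℕ} (F : ℕ → M) (i : Fin (n + 1)) :
    ∑ j ∈ Finset.Ioi i, F j = ∑ j ∈ Finset.Ioc (i : ℕ) n, F j := by
  refine Finset.sum_bij (fun j _ => (j : ℕ)) ?_ ?_ ?_ ?_
  · intro j hj
    have := j.2
    simp only [Finset.mem_Ioi, Fin.lt_def] at hj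
    simp only [Finset.mem_Ioc]; omega
  · intro a _ b _ h; exact Fin.ext h
  · intro b hb
    simp only [Finset.mem_Ioc] at hb
    exact ⟨⟨b, by omega⟩, by simpa [Fin.lt_def] using hb.1, rfl⟩
  · intros; rfl

/-- The element `z_i` of `A(S_q^{2k+1})` if `i ≤ k`, and `0` if `i > k`. -/
def zext (q : ℝ) (k i : ℕ) : SphereAlg q k := if h : i < k + 1 then zgen q ⟨i, h⟩ else 0

theorem zext_fin (q : ℝ) {k : ℕ} (i : Fin (k + 1)) : zext q k i = zgen q i := by
  exact dif_pos i.2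

theorem zext_of_lt (q : ℝ) {k i : ℕ} (h : k < i) : zext q k i = 0 :=
  dif_neg (by omega)

theorem sphereRelations_zext (q : ℝ) {n k : ℕ} (hk : k ≤ n) :
    SphereRelations q (fun i : Fin (n + 1) => zext q k i) (fun i => star (zext q k i)) where
  comm i j h := by
    by_cases hj : k < (j : ℕ)
    · simp [zext_of_lt q hj]
    · have hi : (i : ℕ) < k + 1 := by have := Fin.lt_def.1 h; omega
      have := (sphereRelations_gen q k).comm ⟨i, hi⟩ ⟨j, by omega⟩ h
      simpa only [← zext_fin] using this
  comm_star i j h := by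
    by_cases hj : k < (j : ℕ)
    · simp [zext_of_lt q hj]
    · have hi : (i : ℕ) < k + 1 := by have := Fin.lt_def.1 h; omega
      have := (sphereRelations_gen q k).comm_star ⟨i, hi⟩ ⟨j, by omega⟩ h
      simpa only [← star_zgen, ← zext_fin] using this
  mixed i j h := by
    by_cases hj : k < (j : ℕ)
    · simp [zext_of_lt q hj]
    by_cases hi : k < (i : ℕ)
    · simp [zext_of_lt q hi]
    · have hi' : (i : ℕ) < k + 1 := by omega
      have hj' : (j : ℕ) < k + 1 := by omega
      have hne : (⟨i, hi'⟩ : Fin (k + 1)) ≠ ⟨j, hj'⟩ := by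
        intro h'
        rw [Fin.mk.injEq] at h'
        exact h (Fin.ext h')
      have := (sphereRelations_gen q k).mixed _ _ hne
      simpa only [← star_zgen, ← zext_fin] using this
  self i := by
    rw [sum_fin_Ioi (fun j => zext q k j * star (zext q k j)) i]
    by_cases hi : k < (i : ℕ)
    · rw [Finset.sum_eq_zero]
      · simp [zext_of_lt q hi]
      · intro j hj
        rw [Finset.mem_Ioc] at hj
        rw [zext_of_lt q (show k < j by omega)]; simp
    · have := (sphereRelations_gen q k).self ⟨i, by omega⟩
      simp only [← star_zgen, ← zext_fin] at this
      rw [sum_fin_Ioi (fun j => zext q k j * star (zext q k j))] at this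
      rw [this]
      congr 1
      refine Finset.sum_subset (Finset.Ioc_subset_Ioc_right hk) ?_
      intro j hj hj'
      simp only [Finset.mem_Ioc] at hj hj'
      rw [zext_of_lt q (show k < j by omega)]; simp
  sphere := by
    have := (sphereRelations_gen q k).sphere
    simp only [← star_zgen, ← zext_fin] at this
    rw [Fin.sum_univ_eq_sum_range (fun j => zext q k j * star (zext q k j))] at this ⊢
    rw [← this]
    symm
    refine Finset.sum_subset (by simpa using hk) ?_
    intro j hj hj'
    simp only [Finset.mem_range] at hj hj'
    rw [zext_of_lt q (show k < j by omega)]; simp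

/-- For `k ≤ n`, the *-algebra morphism `A(S_q^{2n+1}) → A(S_q^{2k+1})` with `z_i ↦ z_i` for
`i ≤ k` and `z_i ↦ 0` for `i > k`. -/
def restrictHom (q : ℝ) {n k : ℕ} (hk : k ≤ n) : SphereAlg q n →⋆ₐ[ℂ] SphereAlg q k :=
  liftStar (sphereRelations_zext q hk)

/-! ### The projections `P_{-N}` -/

theorem zext_self (q : ℝ) {n k : ℕ} (hk : k < n + 1) :
    star (zext q n k) * zext q n k = zext q n k * star (zext q n k) +
      ((1 - q ^ 2 : ℝ) : ℂ) • ∑ j ∈ Finset.Ico (k + 1) (n + 1), zext q n j * star (zext q n j) := by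
  have := (sphereRelations_gen q n).self ⟨k, hk⟩
  simp only [← star_zgen, ← zext_fin] at this
  rw [sum_fin_Ioi (fun j => zext q n j * star (zext q n j)), sub_eq_iff_eq_add'] at this
  have hI : Finset.Ioc k n = Finset.Ico (k + 1) (n + 1) := by ext; simp
  rw [← hI]
  exact this

theorem q_trace_aux (q : ℝ) {n k : ℕ} (hk : k ≤ n + 1) :
    ∑ i ∈ Finset.Ico k (n + 1), ((q ^ (2 * i) : ℝ) : ℂ) • (star (zext q n i) * zext q n i) =
      ((q ^ (2 * k) : ℝ) : ℂ) •
        ∑ i ∈ Finset.Ico k (n + 1), zext q n i * star (zext q n i) := by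
  induction hk using Nat.decreasingInduction with
  | self => simp
  | of_succ k hk ih =>
    rw [Finset.sum_eq_sum_Ico_succ_bot hk, Finset.sum_eq_sum_Ico_succ_bot hk, ih,
      zext_self q (by omega), smul_add, smul_add, smul_smul, add_assoc, ← add_smul]
    congr 3
    push_cast
    ring

theorem q_trace (q : ℝ) (n : ℕ) :
    ∑ i : Fin (n + 1), ((q ^ (2 * (i : ℕ)) : ℝ) : ℂ) • (star (zgen q i) * zgen q i) =
      (1 : SphereAlg q n) := by
  have h := q_trace_aux q (n := n) (Nat.zero_le _)
  have h' := (sphereRelations_gen q n).sphere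
  simp only [← star_zgen, ← zext_fin] at h' ⊢
  rw [Fin.sum_univ_eq_sum_range (fun j => zext q n j * star (zext q n j)),
    Finset.range_eq_Ico] at h'
  rw [Fin.sum_univ_eq_sum_range
    (fun i => ((q ^ (2 * i) : ℝ) : ℂ) • (star (zext q n i) * zext q n i)),
    Finset.range_eq_Ico, h, h']
  simp

theorem p_mem (q : ℝ) {n : ℕ} (i j : Fin (n + 1)) :
    star (zgen q i) * zgen q j ∈ projAlg q n :=
  StarAlgebra.subset_adjoin ℂ _ ⟨(i, j), rfl⟩

theorem sum_z_mul_star_z_mem {q : ℝ} (hq : q ≠ 0) {n k : ℕ} (hk : k ≤ n + 1) :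
    ∑ i ∈ Finset.Ico k (n + 1), zext q n i * star (zext q n i) ∈ projAlg q n := by
  have hne : ((q ^ (2 * k) : ℝ) : ℂ) ≠ 0 := by exact_mod_cast pow_ne_zero _ hq
  rw [← inv_smul_smul₀ hne (∑ i ∈ Finset.Ico k (n + 1), zext q n i * star (zext q n i)),
    ← q_trace_aux q hk]
  refine SMulMemClass.smul_mem _ (sum_mem fun i hi => SMulMemClass.smul_mem _ ?_)
  have hi' : i < n + 1 := (Finset.mem_Ico.1 hi).2
  have := p_mem q (n := n) ⟨i, hi'⟩ ⟨i, hi'⟩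
  rwa [← zext_fin] at this

theorem z_mul_star_z_mem {q : ℝ} (hq : q ≠ 0) {n : ℕ} (i j : Fin (n + 1)) :
    zgen q i * star (zgen q j) ∈ projAlg q n := by
  rcases eq_or_ne i j with rfl | hij
  · have h1 := sum_z_mul_star_z_mem hq (n := n) (k := i) (by omega)
    have h2 := sum_z_mul_star_z_mem hq (n := n) (k := i + 1) (by omega)
    rw [Finset.sum_eq_sum_Ico_succ_bot (by omega)] at h1
    have := sub_mem h1 h2
    rwa [add_sub_cancel_right, zext_fin] at this
  · have h := (sphereRelations_gen q n).mixed j i hij.symm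
    have hne : (q : ℂ) ≠ 0 := by exact_mod_cast hq
    rw [← star_zgen] at h
    rw [← inv_smul_smul₀ hne (zgen q i * star (zgen q j)), ← h]
    exact SMulMemClass.smul_mem _ (p_mem q j i)

theorem z_mul_mem {q : ℝ} (hq : q ≠ 0) {n : ℕ} {x : SphereAlg q n}
    (hx : x ∈ projAlg q n) (i j : Fin (n + 1)) :
    zgen q i * x * star (zgen q j) ∈ projAlg q n := by
  induction hx using StarAlgebra.adjoin_induction generalizing i j with
  | mem x hx =>
    obtain ⟨⟨a, b⟩, rfl⟩ := hx
    have := mul_mem (z_mul_star_z_mem hq i a) (z_mul_star_z_mem hq b j)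
    simpa only [mul_assoc] using this
  | algebraMap c =>
    rw [← Algebra.commutes, mul_assoc]
    exact mul_mem (algebraMap_mem _ c) (z_mul_star_z_mem hq i j)
  | add x y _ _ hx hy =>
    rw [mul_add, add_mul]
    exact add_mem (hx i j) (hy i j)
  | mul x y _ _ hx hy =>
    have : zgen q i * (x * y) * star (zgen q j) = zgen q i * x *
        (∑ s : Fin (n + 1), ((q ^ (2 * (s : ℕ)) : ℝ) : ℂ) • (star (zgen q s) * zgen q s)) *
        y * star (zgen q j) := by
      rw [q_trace]; simp only [mul_one, mul_assoc]
    rw [this, Finset.mul_sum, Finset.sum_mul, Finset.sum_mul]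
    refine sum_mem fun s _ => ?_
    rw [mul_smul_comm, smul_mul_assoc, smul_mul_assoc]
    refine SMulMemClass.smul_mem _ ?_
    have := mul_mem (hx i s) (hy s j)
    simpa only [mul_assoc] using this
  | star x _ hx =>
    have := star_mem (hx j i)
    simpa only [star_mul, star_star, mul_assoc] using this

/-- The monomial `z_0^{j_0} z_1^{j_1} ⋯ z_n^{j_n}`. -/
def monomial (q : ℝ) {n : ℕ} (j : Fin (n + 1) → ℕ) : SphereAlg q n :=
  (List.ofFn fun i => zgen q i ^ j i).prod

theorem words_mem {q : ℝ} (hq : q ≠ 0) {n : ℕ} (l l' : List (Fin (n + 1)))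
    (h : l.length = l'.length) :
    (l.map (zgen q)).prod * star (l'.map (zgen q)).prod ∈ projAlg q n := by
  induction l generalizing l' with
  | nil =>
    have : l' = [] := List.length_eq_zero_iff.1 h.symm
    subst this
    simp
  | cons a l ih =>
    cases l' with
    | nil => simp at h
    | cons b l' =>
      have := z_mul_mem hq (ih l' (by simpa using h)) a b
      simpa only [List.map_cons, List.prod_cons, star_mul, mul_assoc] using this

theorem monomial_eq_word (q : ℝ) {n : ℕ} (j : Fin (n + 1) → ℕ) :
    ∃ l : List (Fin (n + 1)), l.length = ∑ i, j i ∧ monomial q j = (l.map (zgen q)).prod := by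
  refine ⟨(List.ofFn fun i => List.replicate (j i) i).flatten, ?_, ?_⟩
  · simp [List.length_flatten, List.map_ofFn, List.sum_ofFn, Function.comp_def, Fin.sum_univ_succ]
  · simp [monomial, List.map_flatten, List.prod_flatten, List.map_ofFn, Function.comp_def]

/-- The `q`-analogue `[m] = (q^m - q^{-m}) / (q - q^{-1})`. -/
def qNum (q : ℝ) (m : ℕ) : ℝ := (q ^ m - (q ^ m)⁻¹) / (q - q⁻¹)

/-- The `q`-factorial `[m]! = [m][m-1]⋯[1]`, with `[0]! = 1`. -/
def qFact (q : ℝ) (m : ℕ) : ℝ := ∏ i ∈ Finset.range m, qNum q (i + 1)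

/-- The `q`-multinomial coefficient `[j_0 + ⋯ + j_n]! / ([j_0]! ⋯ [j_n]!)`. -/
def qMultinomial (q : ℝ) {n : ℕ} (j : Fin (n + 1) → ℕ) : ℝ :=
  qFact q (∑ i, j i) / ∏ i, qFact q (j i)

/-- The multi-indices `(j_0, …, j_n)` with `j_0 + ⋯ + j_n = N`. -/
abbrev MultiIndex (n N : ℕ) : Type :=
  {j : Fin (n + 1) → ℕ // j ∈ Finset.piAntidiag Finset.univ N}

/-- The numerical coefficient
`[j_0,…,j_n]!^{1/2} q^{(1/2) ∑_{r<s} j_r j_s + ∑_r r j_r}` of `psiNeg`. -/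
def psiCoeff (q : ℝ) {n : ℕ} (j : Fin (n + 1) → ℕ) : ℝ :=
  Real.sqrt (qMultinomial q j) *
    q ^ ((1 / 2 : ℝ) * (∑ s : Fin (n + 1), ∑ r ∈ Finset.Iio s, (j r : ℝ) * (j s : ℝ)) +
      ∑ r : Fin (n + 1), ((r : ℕ) : ℝ) * (j r : ℝ))

/-- The component `ψ^{-N}_{j_0,…,j_n}` of the vector `Ψ_{-N}`. -/
def psiNeg (q : ℝ) {n N : ℕ} (j : MultiIndex n N) : SphereAlg q n :=
  (psiCoeff q j.1 : ℂ) • monomial q j.1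

theorem psiNeg_mul_star_mem {q : ℝ} (hq : q ≠ 0) {n N : ℕ} (i j : MultiIndex n N) :
    psiNeg q i * star (psiNeg q j) ∈ projAlg q n := by
  obtain ⟨l, hl, hl'⟩ := monomial_eq_word q i.1
  obtain ⟨m, hm, hm'⟩ := monomial_eq_word q j.1
  have hi := (Finset.mem_piAntidiag.1 i.2).1
  have hj := (Finset.mem_piAntidiag.1 j.2).1
  rw [psiNeg, psiNeg, hl', hm', star_smul, smul_mul_smul_comm]
  refine SMulMemClass.smul_mem _ (words_mem hq l m ?_)
  rw [hl, hm, hi, hj]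

/-- The matrix `P_{-N} = Ψ_{-N} Ψ_{-N}^†` with entries in `A(CP_q^n)`. -/
def projNeg {q : ℝ} (hq : q ∈ Set.Ioo (0 : ℝ) 1) (n N : ℕ) :
    Matrix (MultiIndex n N) (MultiIndex n N) (projAlg q n) :=
  fun i j => ⟨psiNeg q i * star (psiNeg q j), psiNeg_mul_star_mem hq.1.ne' i j⟩

/-! ### The representations `π_k^{(n)}` -/

/-- The Hilbert space `H_n = ℓ²(ℕ^n)`. -/
abbrev HilbN (n : ℕ) : Type := lp (fun _ : Fin n → ℕ => ℂ) 2

/-- The coordinate `m_i` of `m = (m_1, …, m_n)`, with `m_0 = 0`. -/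
def coord {n : ℕ} (m : Fin n → ℕ) : ℕ → ℕ
  | 0 => 0
  | i + 1 => if h : i < n then m ⟨i, h⟩ else 0

/-- `0 ≤ m_1 ≤ ⋯ ≤ m_k` and `m_{k+1} > ⋯ > m_n ≥ 0`. -/
def Admissible {n : ℕ} (k : ℕ) (m : Fin n → ℕ) : Prop :=
  (∀ i < k, coord m i ≤ coord m (i + 1)) ∧
    ∀ i, k + 1 ≤ i → i < n → coord m (i + 1) < coord m i

/-- The labels of the basis vectors that span `V_k^n`. -/
abbrev Label (n k : ℕ) : Type := {m : Fin n → ℕ // Admissible k m}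

theorem weightedComp_bound {ι κ : Type} {w : ι → ℝ} {t : ι → κ} (hw : ∀ i, |w i| ≤ 1)
    (f : lp (fun _ : κ => ℂ) 2) (i : ι) : ‖(w i : ℂ) * f (t i)‖ ≤ ‖f (t i)‖ := by
  rw [norm_mul, Complex.norm_real]
  exact mul_le_of_le_one_left (norm_nonneg _) (hw i)

theorem weightedComp_memℓp {ι κ : Type} {w : ι → ℝ} {t : ι → κ} (ht : Function.Injective t)
    (hw : ∀ i, |w i| ≤ 1) (f : lp (fun _ : κ => ℂ) 2) :
    Memℓp (fun i => (w i : ℂ) * f (t i)) 2 := by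
  refine memℓp_gen (Summable.of_nonneg_of_le (fun i => by positivity) (fun i => ?_)
    (((lp.memℓp f).summable (by norm_num)).comp_injective ht))
  exact Real.rpow_le_rpow (norm_nonneg _) (weightedComp_bound hw f i) (by norm_num)

/-- The operator `ℓ²(κ) → ℓ²(ι)` given by `(T f) i = w i * f (t i)`, for an injective `t` and
weights `w` bounded by `1`. -/
def weightedComp {ι κ : Type} (w : ι → ℝ) (t : ι → κ) (ht : Function.Injective t)
    (hw : ∀ i, |w i| ≤ 1) :
    lp (fun _ : κ => ℂ) 2 →L[ℂ] lp (fun _ : ι => ℂ) 2 :=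
  LinearMap.mkContinuous
    { toFun := fun f => ⟨fun i => (w i : ℂ) * f (t i), weightedComp_memℓp ht hw f⟩
      map_add' := fun f g => by
        ext i
        exact mul_add _ _ _
      map_smul' := fun c f => by
        ext i
        exact mul_left_comm _ _ _ } 1 (fun f => by
    classical
    rw [one_mul]
    refine lp.norm_le_of_forall_sum_le (by norm_num) (norm_nonneg f) fun s => ?_
    refine le_trans ?_ (lp.sum_rpow_le_norm_rpow (by norm_num) f (s.image t))
    rw [Finset.sum_image fun a _ b _ h => ht h]
    refine Finset.sum_le_sum fun i _ => Real.rpow_le_rpow (norm_nonneg _) ?_ (by norm_num)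
    exact weightedComp_bound hw f i)

theorem weightedComp_apply {ι κ : Type} {w : ι → ℝ} {t : ι → κ} (ht : Function.Injective t)
    (hw : ∀ i, |w i| ≤ 1) (f : lp (fun _ : κ => ℂ) 2) (i : ι) :
    weightedComp w t ht hw f i = w i * f (t i) := rfl

theorem adjoint_weightedComp_apply {ι κ : Type} {w : ι → ℝ} {t : ι → κ}
    (ht : Function.Injective t) (hw : ∀ i, |w i| ≤ 1) (f : lp (fun _ : ι => ℂ) 2) (i : ι) :
    ContinuousLinearMap.adjoint (weightedComp w t ht hw) f (t i) = w i * f i := by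
  classical
  have h := ContinuousLinearMap.adjoint_inner_right (weightedComp w t ht hw)
    (lp.single 2 (t i) (1 : ℂ)) f
  have h1 : weightedComp w t ht hw (lp.single 2 (t i) (1 : ℂ)) = lp.single 2 i (w i : ℂ) := by
    ext j
    rw [weightedComp_apply]
    rcases eq_or_ne j i with rfl | hj
    · simp
    · rw [lp.single_apply_ne _ _ _ hj, lp.single_apply_ne _ _ _ (fun h' => hj (ht h'))]; simp
  rw [h1, lp.inner_single_left, lp.inner_single_left] at h
  simpa [mul_comm] using h

theorem adjoint_weightedComp_apply_of_notMem {ι κ : Type} {w : ι → ℝ} {t : ι → κ}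
    (ht : Function.Injective t) (hw : ∀ i, |w i| ≤ 1) (f : lp (fun _ : ι => ℂ) 2) (k : κ)
    (hk : ∀ i, t i ≠ k) :
    ContinuousLinearMap.adjoint (weightedComp w t ht hw) f k = 0 := by
  classical
  have h := ContinuousLinearMap.adjoint_inner_right (weightedComp w t ht hw)
    (lp.single 2 k (1 : ℂ)) f
  have h1 : weightedComp w t ht hw (lp.single 2 k (1 : ℂ)) = 0 := by
    ext j
    rw [weightedComp_apply, lp.single_apply_ne _ _ _ (hk j)]; simp
  rw [h1, lp.inner_single_left] at h
  simpa using h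

/-- The multi-index `m + ε_i^k`, where `ε_i^k` has entries `1` at the places `i + 1, …, k` and
`0` elsewhere. -/
def raise {n : ℕ} (k i : ℕ) (m : Fin n → ℕ) : Fin n → ℕ :=
  fun r => if i ≤ (r : ℕ) ∧ (r : ℕ) < k then m r + 1 else m r

theorem coord_raise {n k : ℕ} (hk : k ≤ n) (i : ℕ) (m : Fin n → ℕ) (s : ℕ) :
    coord (raise k i m) s = if i < s ∧ s ≤ k then coord m s + 1 else coord m s := by
  cases s with
  | zero => simp [coord]
  | succ s =>
    simp only [coord, raise]
    by_cases hs : s < n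
    · simp only [dif_pos hs, Nat.lt_succ_iff, Nat.succ_le_iff]
    · rw [dif_neg hs, dif_neg hs, if_neg (by omega)]

theorem raise_admissible {n k : ℕ} (hk : k ≤ n) (i : ℕ) {m : Fin n → ℕ} (hm : Admissible k m) :
    Admissible k (raise k i m) := by
  refine ⟨fun s hs => ?_, fun s hs hs' => ?_⟩
  · have := hm.1 s hs
    simp only [coord_raise hk]
    split_ifs <;> omega
  · have := hm.2 s hs hs'
    simp only [coord_raise hk]
    split_ifs <;> omega

theorem raise_injective {n : ℕ} (k i : ℕ) : Function.Injective (raise (n := n) k i) := by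
  intro m m' h
  ext r
  have := congrFun h r
  simp only [raise] at this
  split_ifs at this <;> omega

theorem raise_comm {n : ℕ} (k i j : ℕ) (m : Fin n → ℕ) :
    raise k i (raise k j m) = raise k j (raise k i m) := by
  ext r
  simp only [raise]
  split_ifs <;> rfl

/-- `m ↦ m + ε_i^k` on the labels of `V_k^n`. -/
def raiseLabel {n k : ℕ} (hk : k ≤ n) (i : ℕ) (m : Label n k) : Label n k :=
  ⟨raise k i m.1, raise_admissible hk i m.2⟩

theorem raiseLabel_injective {n k : ℕ} (hk : k ≤ n) (i : ℕ) :
    Function.Injective (raiseLabel hk i) := fun _ _ h =>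
  Subtype.ext (raise_injective k i (congrArg Subtype.val h))

theorem raiseLabel_comm {n k : ℕ} (hk : k ≤ n) (i j : ℕ) (m : Label n k) :
    raiseLabel hk i (raiseLabel hk j m) = raiseLabel hk j (raiseLabel hk i m) :=
  Subtype.ext (raise_comm k i j m.1)

theorem exists_raiseLabel_iff {n k : ℕ} (hk : k ≤ n) {i : ℕ} (hi : i ≤ k) (m : Label n k) :
    (∃ m', raiseLabel hk i m' = m) ↔ (i < k → coord m.1 i < coord m.1 (i + 1)) := by
  constructor
  · rintro ⟨m', rfl⟩ h
    have := m'.2.1 i h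
    simp only [raiseLabel, coord_raise hk]
    split_ifs <;> omega
  · intro h
    rcases hi.eq_or_lt with rfl | hi
    · refine ⟨m, Subtype.ext (funext fun r => ?_)⟩
      simp only [raiseLabel, raise]
      exact if_neg (by omega)
    have h := h hi
    have hmono : ∀ s, i < s → s ≤ k → coord m.1 (i + 1) ≤ coord m.1 s := by
      intro s hs
      induction s, hs using Nat.le_induction with
      | base => exact fun _ => le_rfl
      | succ s hs ih => exact fun hsk => (ih (by omega)).trans (m.2.1 s (by omega))
    let l : Fin n → ℕ := fun r => if i ≤ (r : ℕ) ∧ (r : ℕ) < k then m.1 r - 1 else m.1 r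
    have hl : ∀ s, coord l s = if i < s ∧ s ≤ k then coord m.1 s - 1 else coord m.1 s := by
      intro s
      cases s with
      | zero => simp [coord]
      | succ s =>
        simp only [coord, l]
        by_cases hs : s < n
        · simp only [dif_pos hs, Nat.lt_succ_iff, Nat.succ_le_iff]
        · rw [dif_neg hs, dif_neg hs, if_neg (by omega)]
    refine ⟨⟨l, fun s hs => ?_, fun s hs hs' => ?_⟩, Subtype.ext (funext fun r => ?_)⟩
    · have h1 := m.2.1 s hs
      have h2 := hmono (s + 1)
      rw [hl, hl]
      rcases lt_trichotomy s i with h3 | rfl | h3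
      · rw [if_neg (by omega), if_neg (by omega)]; exact h1
      · rw [if_neg (by omega), if_pos (by omega)]; omega
      · rw [if_pos (by omega), if_pos (by omega)]; omega
    · have h1 := m.2.2 s hs hs'
      rw [hl, hl, if_neg (by omega), if_neg (by omega)]; exact h1
    · simp only [raiseLabel, raise, l]
      split_ifs with hr
      · have := hmono (r + 1) (by omega) (by omega)
        have hr' : coord m.1 (r + 1) = m.1 r := by simp [coord]
        omega
      · rfl

/-- The weight of `π_k^{(n)}(z_i)` on the basis vector labelled by an admissible `m`:
`q^{m_i} (1 - q^{2(m_{i+1} - m_i + 1)})^{1/2}` for `i < k`, `q^{m_k}` for `i = k`, and `0` for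
`i > k`. (For admissible `m`, the subtraction of natural numbers below does not truncate.) -/
def weight (q : ℝ) {n : ℕ} (k i : ℕ) (m : Fin n → ℕ) : ℝ :=
  if i < k then
    q ^ coord m i * Real.sqrt (1 - q ^ (2 * (coord m (i + 1) + 1 - coord m i)))
  else if i = k then q ^ coord m k else 0

theorem abs_weight_le {q : ℝ} (hq : q ∈ Set.Ioo (0 : ℝ) 1) {n : ℕ} (k i : ℕ) (m : Fin n → ℕ) :
    |weight q k i m| ≤ 1 := by
  have hp : ∀ a : ℕ, 0 ≤ q ^ a ∧ q ^ a ≤ 1 := fun a =>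
    ⟨pow_nonneg hq.1.le a, pow_le_one₀ hq.1.le hq.2.le⟩
  unfold weight
  split_ifs
  · rw [abs_of_nonneg (mul_nonneg (hp _).1 (Real.sqrt_nonneg _))]
    refine mul_le_one₀ (hp _).2 (Real.sqrt_nonneg _) (Real.sqrt_le_one.2 ?_)
    linarith [(hp (2 * (coord m (i + 1) + 1 - coord m i))).1]
  · rw [abs_of_nonneg (hp _).1]; exact (hp _).2
  · simp

theorem weight_raise_of_lt {q : ℝ} {n k : ℕ} (hk : k ≤ n) {i j : ℕ} (hij : i < j)
    (m : Fin n → ℕ) : weight q k i (raise k j m) = weight q k i m := by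
  unfold weight
  simp only [coord_raise hk]
  split_ifs <;> first | rfl | omega

theorem weight_raise_of_gt {q : ℝ} {n k : ℕ} (hk : k ≤ n) {i j : ℕ} (hij : j < i)
    (m : Fin n → ℕ) : weight q k i (raise k j m) = q * weight q k i m := by
  unfold weight
  simp only [coord_raise hk]
  split_ifs
  all_goals first
    | omega
    | (rw [show ∀ a b : ℕ, a + 1 + 1 - (b + 1) = a + 1 - b by omega]; ring)
    | ring

/-- The operator `z_i^*` on `ℓ²(Label n k)`: `(z_i^* f)(m) = weight(m) f(m + ε_i^k)`. -/
def zsOp {q : ℝ} (hq : q ∈ Set.Ioo (0 : ℝ) 1) {n k : ℕ} (hk : k ≤ n) (i : ℕ) :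
    lp (fun _ : Label n k => ℂ) 2 →L[ℂ] lp (fun _ : Label n k => ℂ) 2 :=
  weightedComp (fun m => weight q k i m.1) (raiseLabel hk i) (raiseLabel_injective hk i)
    (fun m => abs_weight_le hq k i m.1)

/-- The operator `z_i` on `ℓ²(Label n k)`, the adjoint of `zsOp`; it is the weighted shift
`|m⟩ ↦ weight(m) |m + ε_i^k⟩` (see `zOp_single`). -/
def zOp {q : ℝ} (hq : q ∈ Set.Ioo (0 : ℝ) 1) {n k : ℕ} (hk : k ≤ n) (i : ℕ) :
    lp (fun _ : Label n k => ℂ) 2 →L[ℂ] lp (fun _ : Label n k => ℂ) 2 :=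
  ContinuousLinearMap.adjoint (zsOp hq hk i)

section Relations

variable {q : ℝ} (hq : q ∈ Set.Ioo (0 : ℝ) 1) {n k : ℕ} (hk : k ≤ n)

theorem zsOp_apply (i : ℕ) (f : lp (fun _ : Label n k => ℂ) 2) (m : Label n k) :
    zsOp hq hk i f m = weight q k i m.1 * f (raiseLabel hk i m) := rfl

theorem zOp_apply (i : ℕ) (f : lp (fun _ : Label n k => ℂ) 2) (m : Label n k) :
    zOp hq hk i f (raiseLabel hk i m) = weight q k i m.1 * f m :=
  adjoint_weightedComp_apply (raiseLabel_injective hk i) (fun m => abs_weight_le hq k i m.1) f m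

theorem zOp_apply_of_notMem (i : ℕ) (f : lp (fun _ : Label n k => ℂ) 2) (m : Label n k)
    (hm : ∀ m', raiseLabel hk i m' ≠ m) : zOp hq hk i f m = 0 :=
  adjoint_weightedComp_apply_of_notMem (raiseLabel_injective hk i)
    (fun m => abs_weight_le hq k i m.1) f m hm

theorem zsOp_of_lt {i : ℕ} (hi : k < i) : zsOp hq hk i = 0 := by
  ext f m
  rw [zsOp_apply, weight, if_neg (by omega), if_neg (by omega)]
  simp

theorem zOp_of_lt {i : ℕ} (hi : k < i) : zOp hq hk i = 0 := by
  rw [zOp, zsOp_of_lt hq hk hi, map_zero]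

theorem zOp_single [DecidableEq (Label n k)] (i : ℕ) (m : Label n k) :
    zOp hq hk i (lp.single 2 m (1 : ℂ)) =
      (weight q k i m.1 : ℂ) • lp.single 2 (raiseLabel hk i m) (1 : ℂ) := by
  ext m'
  by_cases h : ∃ m'', raiseLabel hk i m'' = m'
  · obtain ⟨m'', rfl⟩ := h
    rw [zOp_apply]
    rcases eq_or_ne m'' m with rfl | hne
    · rw [lp.coeFn_smul, Pi.smul_apply]
      simp
    · have h' : raiseLabel hk i m'' ≠ raiseLabel hk i m :=
        fun h' => hne (raiseLabel_injective hk i h')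
      rw [lp.single_apply_ne _ _ _ hne, lp.coeFn_smul, Pi.smul_apply,
        lp.single_apply_ne _ _ _ h']
      simp
  · push Not at h
    rw [zOp_apply_of_notMem hq hk i _ m' h, lp.coeFn_smul, Pi.smul_apply,
      lp.single_apply_ne _ _ _ (h m).symm]
    simp

theorem zsOp_mul (i j : ℕ) (hij : i < j) :
    zsOp hq hk j * zsOp hq hk i = ((q⁻¹ : ℝ) : ℂ) • (zsOp hq hk i * zsOp hq hk j) := by
  ext f m
  have hq0 : (q : ℂ) ≠ 0 := by exact_mod_cast hq.1.ne'
  change zsOp hq hk j (zsOp hq hk i f) m =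
    ((q⁻¹ : ℝ) : ℂ) * zsOp hq hk i (zsOp hq hk j f) m
  simp only [zsOp_apply]
  rw [raiseLabel_comm]
  simp only [raiseLabel, weight_raise_of_lt hk hij, weight_raise_of_gt hk hij]
  push_cast
  field_simp

theorem zsOp_mul_zOp (i j : ℕ) (hij : i ≠ j) :
    zsOp hq hk i * zOp hq hk j = (q : ℂ) • (zOp hq hk j * zsOp hq hk i) := by
  rcases lt_or_ge k j with hj | hj
  · simp [zOp_of_lt hq hk hj]
  rcases lt_or_ge k i with hi | hi
  · simp [zsOp_of_lt hq hk hi]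
  ext f m
  change zsOp hq hk i (zOp hq hk j f) m = (q : ℂ) * zOp hq hk j (zsOp hq hk i f) m
  rw [zsOp_apply]
  by_cases h : ∃ m', raiseLabel hk j m' = m
  · obtain ⟨m', rfl⟩ := h
    rw [raiseLabel_comm, zOp_apply, zOp_apply, zsOp_apply]
    simp only [raiseLabel]
    rcases lt_or_gt_of_ne hij with hlt | hgt
    · simp only [weight_raise_of_lt hk hlt, weight_raise_of_gt hk hlt]
      push_cast; ring
    · simp only [weight_raise_of_lt hk hgt, weight_raise_of_gt hk hgt]
      push_cast; ring
  · have h' : ¬ ∃ m', raiseLabel hk j m' = raiseLabel hk i m := by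
      rw [exists_raiseLabel_iff hk hj] at h ⊢
      intro hh
      refine h fun hjk => ?_
      have := hh hjk
      simp only [raiseLabel, coord_raise hk] at this
      split_ifs at this <;> omega
    push Not at h h'
    rw [zOp_apply_of_notMem hq hk j _ _ h, zOp_apply_of_notMem hq hk j _ _ h']
    simp

theorem one_sub_pow_nonneg {q : ℝ} (hq : q ∈ Set.Ioo (0 : ℝ) 1) (a : ℕ) : 0 ≤ 1 - q ^ a := by
  linarith [pow_le_one₀ (n := a) hq.1.le hq.2.le]

/-- `q^{2 m_i}` for `i ≤ k` and `0` for `i > k`: the eigenvalue of `∑_{j ≥ i} z_j z_j^*`. -/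
def tailWeight (q : ℝ) {n : ℕ} (k i : ℕ) (m : Fin n → ℕ) : ℝ :=
  if i ≤ k then q ^ (2 * coord m i) else 0

theorem zOp_zsOp_apply (i : ℕ) (f : lp (fun _ : Label n k => ℂ) 2) (m : Label n k) :
    (zOp hq hk i * zsOp hq hk i) f m =
      ((tailWeight q k i m.1 - tailWeight q k (i + 1) m.1 : ℝ) : ℂ) * f m := by
  change zOp hq hk i (zsOp hq hk i f) m = _
  rcases lt_or_ge k i with hi | hi
  · rw [zOp_of_lt hq hk hi, tailWeight, tailWeight, if_neg (by omega), if_neg (by omega)]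
    simp
  by_cases h : ∃ m', raiseLabel hk i m' = m
  · obtain ⟨m', rfl⟩ := h
    rw [zOp_apply, zsOp_apply, ← mul_assoc, ← Complex.ofReal_mul]
    congr 2
    simp only [tailWeight, raiseLabel, weight, coord_raise hk]
    rcases hi.eq_or_lt with rfl | hi
    · simp; ring
    · have h1 := m'.2.1 i hi
      have h2 := one_sub_pow_nonneg hq (2 * (coord m'.1 (i + 1) + 1 - coord m'.1 i))
      rw [if_pos hi, if_pos hi.le, if_pos (show i + 1 ≤ k by omega),
        if_neg (show ¬ (i < i ∧ i ≤ k) by omega), if_pos (show i < i + 1 ∧ i + 1 ≤ k by omega),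
        mul_mul_mul_comm, Real.mul_self_sqrt h2, mul_sub, mul_one, ← pow_add, ← pow_add]
      congr 2 <;> omega
  · have h' := h
    rw [exists_raiseLabel_iff hk hi] at h'
    push Not at h h'
    rw [zOp_apply_of_notMem hq hk i _ _ h, tailWeight, tailWeight, if_pos hi,
      if_pos (by omega), le_antisymm (m.2.1 i h'.1) h'.2]
    simp

theorem zsOp_zOp_apply (i : ℕ) (f : lp (fun _ : Label n k => ℂ) 2) (m : Label n k) :
    (zsOp hq hk i * zOp hq hk i) f m =
      ((tailWeight q k i m.1 - q ^ 2 * tailWeight q k (i + 1) m.1 : ℝ) : ℂ) * f m := by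
  change zsOp hq hk i (zOp hq hk i f) m = _
  rw [zsOp_apply, zOp_apply, ← mul_assoc, ← Complex.ofReal_mul]
  congr 2
  simp only [tailWeight, weight]
  rcases lt_trichotomy i k with hi | rfl | hi
  · have h1 := m.2.1 i hi
    have h2 := one_sub_pow_nonneg hq (2 * (coord m.1 (i + 1) + 1 - coord m.1 i))
    rw [if_pos hi, if_pos hi.le, if_pos (by omega),
      mul_mul_mul_comm, Real.mul_self_sqrt h2, mul_sub, mul_one, ← pow_add, ← pow_add, ← pow_add]
    congr 2 <;> omega
  · simp; ring
  · rw [if_neg (by omega), if_neg (by omega), if_neg (by omega), if_neg (by omega)]; simp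

theorem sum_tailWeight (a : ℕ) (m : Fin n → ℕ) (ha : a ≤ n + 1) :
    ∑ j ∈ Finset.Ico a (n + 1), (tailWeight q k j m - tailWeight q k (j + 1) m) =
      tailWeight q k a m - tailWeight q k (n + 1) m := by
  have := Finset.sum_Ico_sub (fun j => tailWeight q k j m) ha
  rw [← neg_sub (tailWeight q k (n + 1) m), ← this, ← Finset.sum_neg_distrib]
  simp

theorem sum_zOp_zsOp_apply (a : ℕ) (ha : a ≤ n + 1) (f : lp (fun _ : Label n k => ℂ) 2)
    (m : Label n k) :
    (∑ j ∈ Finset.Ico a (n + 1), zOp hq hk j * zsOp hq hk j) f m =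
      (tailWeight q k a m.1 : ℂ) * f m := by
  rw [_root_.sum_apply, lp.coeFn_sum, Finset.sum_apply]
  simp only [zOp_zsOp_apply]
  rw [← Finset.sum_mul, ← Complex.ofReal_sum, sum_tailWeight a m.1 ha]
  have : tailWeight q k (n + 1) m.1 = 0 := if_neg (by omega)
  rw [this, sub_zero]

theorem sphereRelations_op :
    SphereRelations q (fun i : Fin (n + 1) => zOp hq hk i) (fun i => star (zOp hq hk i)) := by
  have hstar : ∀ i, star (zOp hq hk i) = zsOp hq hk i := fun i =>
    ContinuousLinearMap.adjoint_adjoint (zsOp hq hk i)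
  have hstar' : ∀ i, star (zsOp hq hk i) = zOp hq hk i := fun i => rfl
  simp only [hstar]
  refine ⟨fun i j h => ?_, fun i j h => zsOp_mul hq hk i j h, fun i j h => ?_, fun i => ?_, ?_⟩
  · have := congrArg star (zsOp_mul hq hk i j h)
    simpa only [star_mul, star_smul, hstar', RCLike.star_def, Complex.conj_ofReal] using this
  · exact zsOp_mul_zOp hq hk i j (fun h' => h (Fin.ext h'))
  · rw [sum_fin_Ioi (fun j => zOp hq hk j * zsOp hq hk j)]
    have hI : Finset.Ioc (i : ℕ) n = Finset.Ico ((i : ℕ) + 1) (n + 1) := by ext; simp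
    rw [hI]
    ext f m
    change (zsOp hq hk i * zOp hq hk i) f m - (zOp hq hk i * zsOp hq hk i) f m =
      ((1 - q ^ 2 : ℝ) : ℂ) *
        (∑ j ∈ Finset.Ico ((i : ℕ) + 1) (n + 1), zOp hq hk j * zsOp hq hk j) f m
    rw [zsOp_zOp_apply, zOp_zsOp_apply, sum_zOp_zsOp_apply hq hk _ (by omega)]
    push_cast
    ring
  · rw [Fin.sum_univ_eq_sum_range (fun j => zOp hq hk j * zsOp hq hk j), Finset.range_eq_Ico]
    ext f m
    rw [sum_zOp_zsOp_apply hq hk _ (by omega)]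
    simp [tailWeight, coord]

end Relations

/-- The restriction of `π_k^{(n)}` to the closure `ℓ²(Label n k)` of `V_k^n`. -/
def repOn {q : ℝ} (hq : q ∈ Set.Ioo (0 : ℝ) 1) {n k : ℕ} (hk : k ≤ n) :
    SphereAlg q n →⋆ₐ[ℂ]
      (lp (fun _ : Label n k => ℂ) 2 →L[ℂ] lp (fun _ : Label n k => ℂ) 2) :=
  liftStar (sphereRelations_op hq hk)

/-- The coisometry `H_n → ℓ²(Label n k)` that restricts functions to the labels of `V_k^n`; its
adjoint is extension by zero. -/
def restrictLabel (n k : ℕ) : HilbN n →L[ℂ] lp (fun _ : Label n k => ℂ) 2 :=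
  weightedComp (fun _ => 1) Subtype.val Subtype.val_injective (by simp)

theorem restrictLabel_mul_adjoint (n k : ℕ) (f : lp (fun _ : Label n k => ℂ) 2) :
    restrictLabel n k (ContinuousLinearMap.adjoint (restrictLabel n k) f) = f := by
  ext m
  unfold restrictLabel
  rw [weightedComp_apply, adjoint_weightedComp_apply]
  simp

/-- The representation `π_k^{(n)}` of `A(S_q^{2n+1})` on `H_n`: it is `repOn` on the closure of
`V_k^n` and it is identically zero on the orthogonal complement (so it is in general not
unital). -/
def piRep {q : ℝ} (hq : q ∈ Set.Ioo (0 : ℝ) 1) {n k : ℕ} (hk : k ≤ n) :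
    SphereAlg q n →⋆ₙₐ[ℂ] (HilbN n →L[ℂ] HilbN n) where
  toFun a := ContinuousLinearMap.adjoint (restrictLabel n k) ∘L repOn hq hk a ∘L
    restrictLabel n k
  map_smul' c a := by
    ext f m
    simp
  map_zero' := by
    ext f m
    simp
  map_add' a b := by
    ext f m
    simp
  map_mul' a b := by
    ext f : 1
    simp [restrictLabel_mul_adjoint]
  map_star' a := by
    rw [map_star, ContinuousLinearMap.star_eq_adjoint, ContinuousLinearMap.star_eq_adjoint,
      ContinuousLinearMap.adjoint_comp, ContinuousLinearMap.adjoint_comp,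
      ContinuousLinearMap.adjoint_adjoint]
    rfl

/-- On basis vectors, `π_k^{(n)}(z_i)|m⟩ = weight(m) |m + ε_i^k⟩` if `m` is admissible, and
`π_k^{(n)}(z_i)|m⟩ = 0` otherwise. -/
theorem piRep_zgen_single {q : ℝ} (hq : q ∈ Set.Ioo (0 : ℝ) 1) {n k : ℕ} (hk : k ≤ n)
    (i : Fin (n + 1)) (m : Fin n → ℕ) [Decidable (Admissible k m)] :
    piRep hq hk (zgen q i) (lp.single 2 m (1 : ℂ)) =
      if Admissible k m then
        (weight q k i m : ℂ) • lp.single 2 (raise k i m) (1 : ℂ)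
      else 0 := by
  classical
  change ContinuousLinearMap.adjoint (restrictLabel n k)
    (repOn hq hk (zgen q i) (restrictLabel n k (lp.single 2 m (1 : ℂ)))) = _
  have hz : repOn hq hk (zgen q i) = zOp hq hk i := liftStar_z (sphereRelations_op hq hk) i
  split_ifs with h
  · have hr : restrictLabel n k (lp.single 2 m (1 : ℂ)) = lp.single 2 ⟨m, h⟩ (1 : ℂ) := by
      ext m'
      change ((1 : ℝ) : ℂ) * (lp.single 2 m (1 : ℂ) : HilbN n) m'.1 = _
      rcases eq_or_ne m' ⟨m, h⟩ with rfl | hne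
      · simp
      · rw [lp.single_apply_ne _ _ _ hne,
          lp.single_apply_ne _ _ _ (fun h' => hne (Subtype.ext h'))]
        simp
    rw [hr, hz, zOp_single, map_smul]
    congr 1
    ext m'
    by_cases h' : Admissible k m'
    · refine (adjoint_weightedComp_apply (w := fun _ => 1) Subtype.val_injective (by simp) _
        (⟨m', h'⟩ : Label n k)).trans ?_
      rcases eq_or_ne m' (raise k i m) with rfl | hne
      · rw [lp.single_apply_self]
        exact (congrArg _ (lp.single_apply_self ..)).trans (by simp)
      · rw [lp.single_apply_ne _ _ _ hne,
          lp.single_apply_ne _ _ _ (fun h' => hne (congrArg Subtype.val h'))]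
        simp
    · refine (adjoint_weightedComp_apply_of_notMem (w := fun _ => 1) Subtype.val_injective
        (by simp) _ m' (fun l hl => h' (hl ▸ l.2))).trans ?_
      rw [lp.single_apply_ne]
      rintro rfl
      exact h' (raise_admissible hk i h)
  · have hr : restrictLabel n k (lp.single 2 m (1 : ℂ)) = 0 := by
      ext m'
      change ((1 : ℝ) : ℂ) * (lp.single 2 m (1 : ℂ) : HilbN n) m'.1 = _
      rw [lp.single_apply_ne]
      · simp
      · intro h'
        exact h (h' ▸ m'.2)
    rw [hr, map_zero, map_zero]

/-! ### The index pairing -/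

/-- `π_+^{(n)} = ∑_{k even} π_k^{(n)}`. -/
def piPlus {q : ℝ} (hq : q ∈ Set.Ioo (0 : ℝ) 1) (n : ℕ) (a : SphereAlg q n) :
    HilbN n →L[ℂ] HilbN n :=
  ∑ k : Fin (n + 1), if Even (k : ℕ) then piRep hq (Nat.lt_succ_iff.1 k.2) a else 0

/-- `π_-^{(n)} = ∑_{k odd} π_k^{(n)}`. -/
def piMinus {q : ℝ} (hq : q ∈ Set.Ioo (0 : ℝ) 1) (n : ℕ) (a : SphereAlg q n) :
    HilbN n →L[ℂ] HilbN n :=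
  ∑ k : Fin (n + 1), if Odd (k : ℕ) then piRep hq (Nat.lt_succ_iff.1 k.2) a else 0

/-- A bounded operator `T` is of trace class if `∑_i ⟨b_i, |T| b_i⟩` converges for orthonormal
bases `b`, where `|T| = (T^* T)^{1/2}`. -/
def IsTraceClass {H : Type} [NormedAddCommGroup H] [InnerProductSpace ℂ H] [CompleteSpace H]
    (T : H →L[ℂ] H) : Prop :=
  ∀ (ι : Type) (b : HilbertBasis ι ℂ H), Summable fun i => inner ℂ (b i) (CFC.abs T (b i))

/-- `T` is of trace class with trace `c`. -/
def HasTrace {H : Type} [NormedAddCommGroup H] [InnerProductSpace ℂ H] [CompleteSpace H]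
    (T : H →L[ℂ] H) (c : ℂ) : Prop :=
  IsTraceClass T ∧
    ∀ (ι : Type) (b : HilbertBasis ι ℂ H), HasSum (fun i => inner ℂ (b i) (T (b i))) c

/-- For a square matrix `P` with entries in `A(CP_q^n)`, the operator
`(π_+^{(k)} - π_-^{(k)})(Tr P)` on `H_k`; elements of `A(CP_q^n)` act through
`A(CP_q^n) → A(CP_q^k)`. -/
def pairingOperator {q : ℝ} (hq : q ∈ Set.Ioo (0 : ℝ) 1) {n k : ℕ} (hk : k ≤ n) {ι : Type}
    [Fintype ι] (P : Matrix ι ι (projAlg q n)) : HilbN k →L[ℂ] HilbN k :=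
  piPlus hq k (restrictHom q hk (P.trace : projAlg q n)) -
    piMinus hq k (restrictHom q hk (P.trace : projAlg q n))

/-- The index pairing of the class of the `k`-th Fredholm module with the class of a projection `P`
over `A(CP_q^n)` is defined and equal to `c`. -/
def HasIndexPairing {q : ℝ} (hq : q ∈ Set.Ioo (0 : ℝ) 1) {n k : ℕ} (hk : k ≤ n) {ι : Type}
    [Fintype ι] (P : Matrix ι ι (projAlg q n)) (c : ℂ) : Prop :=
  IsStarProjection P ∧ HasTrace (pairingOperator hq hk P) c

end QuantumProjective

end

noncomputable section

namespace QuantumProjective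

/-! ### The recursion for the monomials -/

/-! Let `c_a` be the coefficient `psiCoeff q a`, let `z^a` be the ordered monomial and let `T_N = Tr
P_{-N}`. Everything rests on one recursion, `sum_psiCoeff_sq_succ`: if `G (r y) = r² G y` for real
`r`, then `∑_{|a|=N+1} c_a² G(z^a) = ∑_{|a|=N} ∑_i q^{2i} c_a² G(z_i z^a)`. Taking `G y = y^* y` and
inserting `∑_i q^{2i} z_i^* z_i = 1` gives `Ψ^† Ψ = 1` by induction, so `P_{-N}` is a projection.
Taking `G y = y y^*` gives `T_{N+1} = ∑_i q^{2i} z_i T_N z_i^*`.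

In the representation `π_j^{(k)}` the element `∑_{s ≥ i} z_s z_s^*` is diagonal with eigenvalue `x_i
= q^{2 m_i}` for `i ≤ j` and `x_i = 0` for `i > j`. Since `z_i` is a weighted shift, the recursion
shows that `T_N` is diagonal too, with an eigenvalue that is one fixed polynomial `traceEigen` in
`x`, the same for all `j` (`repOn_restrictHom_trace`).

Trace class, for `k > 0`: a label `m` is admissible for no `j` or for exactly two consecutive values
`b` and `b + 1`, where `m_{b+1}` is the largest entry. Passing from `b + 1` to `b` only replaces
`x_{b+1} = q^{2 m_{b+1}}` by `0`. Hence the two contributions cancel up to `O(q^{2 max m})`, which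
is summable over the labels.

Value of the trace: sum over the labels with entries at most `M` and let `M → ∞`. After reindexing
the `i`-th term of the recursion by `m ↦ m + ε_i`, the sum over `i` telescopes to `1`, so `T_{N+1}`
and `T_N` have the same truncated sum in `π_j^{(k)}` except for the labels with `j > 0` and `m_j =
M`, which a shift with `i < j` pushes out of the box (`sum_labelBox_traceEigen_succ`). Deleting that
entry yields the labels of `π_{j-1}^{(k-1)}`; replacing `x_j = q^{2M}` by `0` costs `O(q^{2M})` for
each of polynomially many labels (`tendsto_boundary`). The change of parity of `j` turns the loss
into a gain, and the limits satisfy Pascal's rule `t(N+1, k+1) = t(N, k+1) + t(N, k)`. -/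

theorem mul_pow_of_mul_eq_smul {B : Type*} [Ring B] [Algebra ℂ B] {c : ℂ} {x y : B}
    (h : y * x = c • (x * y)) (a : ℕ) : y * x ^ a = c ^ a • (x ^ a * y) := by
  induction a with
  | zero => simp
  | succ a ih =>
    rw [pow_succ, ← mul_assoc, ih, smul_mul_assoc, mul_assoc, h, mul_smul_comm, smul_smul,
      ← pow_succ, mul_assoc]

/-- Moving `z i` to its place in the ordered product crosses only the factors `z s` with `s < i`,
and each of the `a s` copies costs one factor `c`. -/
theorem mul_prod_ofFn_pow {B : Type*} [Ring B] [Algebra ℂ B] {c : ℂ} {m : ℕ} (z : Fin m → B)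
    (h : ∀ i j, i < j → z j * z i = c • (z i * z j)) (a : Fin m → ℕ) (i : Fin m) :
    z i * (List.ofFn fun s => z s ^ a s).prod =
      c ^ (∑ s, if s < i then a s else 0) •
        (List.ofFn fun s => z s ^ (a + Pi.single i 1 : Fin m → ℕ) s).prod := by
  induction m with
  | zero => exact i.elim0
  | succ m ih =>
    simp only [List.ofFn_succ, List.prod_cons]
    cases i using Fin.cases with
    | zero => simp [← mul_assoc, pow_succ']
    | succ i =>
      have hi := ih (fun s => z s.succ) (fun r s hrs => h _ _ (Fin.succ_lt_succ_iff.2 hrs))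
        (fun s => a s.succ) i
      rw [← mul_assoc, mul_pow_of_mul_eq_smul (h 0 i.succ (Fin.succ_pos i)), smul_mul_assoc,
        mul_assoc, hi, mul_smul_comm, smul_smul, ← pow_add, Fin.sum_univ_succ]
      simp [Pi.single_apply, (Fin.succ_ne_zero _).symm]

theorem zgen_mul_monomial {q : ℝ} (hq : q ≠ 0) {n : ℕ} (a : Fin (n + 1) → ℕ)
    (i : Fin (n + 1)) :
    (zgen q i : SphereAlg q n) * monomial q a =
      ((q ^ (∑ s, if s < i then a s else 0) : ℝ) : ℂ) • monomial q (a + Pi.single i 1) := by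
  have := mul_prod_ofFn_pow (c := (q : ℂ)) (zgen q : Fin (n + 1) → SphereAlg q n)
    (fun i j hij => by
      rw [(sphereRelations_gen q n).comm i j hij, smul_smul]
      have : (q : ℂ) ≠ 0 := by exact_mod_cast hq
      simp [this]) a i
  rw [Complex.ofReal_pow]
  exact this

/-! ### `q`-numbers and the coefficients of `psiNeg`. -/

theorem qNum_zero (q : ℝ) : qNum q 0 = 0 := by simp [qNum]

theorem sub_inv_neg {q : ℝ} (hq : q ∈ Set.Ioo (0 : ℝ) 1) : q - q⁻¹ < 0 := by
  have := (one_lt_inv₀ hq.1).2 hq.2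
  linarith [hq.2]

theorem qNum_mul_pow {q : ℝ} (hq : q ∈ Set.Ioo (0 : ℝ) 1) (m : ℕ) :
    qNum q m * q ^ m = (q ^ (2 * m) - 1) / (q - q⁻¹) := by
  have := pow_ne_zero m hq.1.ne'
  rw [qNum, div_mul_eq_mul_div, sub_mul, inv_mul_cancel₀ this, ← pow_add, two_mul]

theorem qNum_pos {q : ℝ} (hq : q ∈ Set.Ioo (0 : ℝ) 1) (m : ℕ) : 0 < qNum q (m + 1) := by
  refine div_pos_of_neg_of_neg ?_ (sub_inv_neg hq)
  have h1 : q ^ (m + 1) < 1 := pow_lt_one₀ hq.1.le hq.2 (by omega)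
  have := (one_lt_inv₀ (pow_pos hq.1 (m + 1))).2 h1
  linarith

theorem qFact_pos {q : ℝ} (hq : q ∈ Set.Ioo (0 : ℝ) 1) (m : ℕ) : 0 < qFact q m :=
  Finset.prod_pos fun i _ => qNum_pos hq i

theorem qFact_succ (q : ℝ) (m : ℕ) : qFact q (m + 1) = qFact q m * qNum q (m + 1) :=
  Finset.prod_range_succ _ _

/-- Up to the factor `q - q⁻¹`, the summand is `q^{2(A_i + a_i)} - q^{2 A_i}` with `A_i` the sum of
the earlier entries, so the sum telescopes. -/
theorem sum_pow_mul_qNum {q : ℝ} (hq : q ∈ Set.Ioo (0 : ℝ) 1) {m : ℕ} (a : Fin m → ℕ) :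
    ∑ i, q ^ (2 * ∑ s, if s < i then a s else 0) * (qNum q (a i) * q ^ a i) =
      qNum q (∑ i, a i) * q ^ (∑ i, a i) := by
  simp only [qNum_mul_pow hq, ← mul_div_assoc, ← Finset.sum_div]
  congr 1
  induction m with
  | zero => simp
  | succ m ih =>
    rw [Fin.sum_univ_succ]
    simp only [Fin.sum_univ_succ, Fin.succ_lt_succ_iff, Fin.succ_pos, if_true, Fin.not_lt_zero,
      if_false, mul_add, pow_add, mul_assoc]
    rw [← Finset.mul_sum, ih (fun s => a s.succ)]
    simp
    ring

/-- Makes the exponent in `psiCoeff` symmetric in the indices, so that the effect of raising a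
single entry can be read off. -/
theorem two_mul_sum_Iio_mul {m : ℕ} (a : Fin m → ℝ) :
    2 * ∑ s : Fin m, ∑ r ∈ Finset.Iio s, a r * a s = (∑ i, a i) ^ 2 - ∑ i, a i ^ 2 := by
  have h (s : Fin m) : ∑ r ∈ Finset.Iio s, a r * a s = ∑ r, if r < s then a r * a s else 0 := by
    rw [← Finset.sum_filter]
    congr 1
    ext; simp
  simp only [h]
  induction m with
  | zero => simp
  | succ m ih =>
    have := ih (fun s => a s.succ) (fun s => by
      rw [← Finset.sum_filter]
      congr 1
      ext; simp)
    simp only [Fin.sum_univ_succ, Fin.succ_lt_succ_iff, Fin.succ_pos, if_true, Fin.not_lt_zero,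
      if_false, Finset.sum_const_zero, zero_add, Finset.sum_add_distrib, mul_add, this,
      ← Finset.mul_sum]
    ring

theorem qMultinomial_nonneg {q : ℝ} (hq : q ∈ Set.Ioo (0 : ℝ) 1) {n : ℕ}
    (a : Fin (n + 1) → ℕ) : 0 ≤ qMultinomial q a :=
  div_nonneg (qFact_pos hq _).le (Finset.prod_nonneg fun _ _ => (qFact_pos hq _).le)

theorem sum_add_single {m : ℕ} (a : Fin m → ℕ) (i : Fin m) :
    ∑ s, (a + Pi.single i 1 : Fin m → ℕ) s = ∑ s, a s + 1 := by
  simp [Finset.sum_add_distrib]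

theorem qMultinomial_add_single {q : ℝ} (hq : q ∈ Set.Ioo (0 : ℝ) 1) {n : ℕ}
    (a : Fin (n + 1) → ℕ) (i : Fin (n + 1)) :
    qMultinomial q (a + Pi.single i 1) * qNum q (a i + 1) =
      qMultinomial q a * qNum q (∑ s, a s + 1) := by
  have h : ∏ s, qFact q ((a + Pi.single i 1 : Fin (n + 1) → ℕ) s) =
      (∏ s, qFact q (a s)) * qNum q (a i + 1) := by
    rw [Fintype.prod_eq_mul_prod_compl i, Fintype.prod_eq_mul_prod_compl i (fun s => qFact q (a s)),
      Finset.prod_congr rfl (g := fun s => qFact q (a s))]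
    · simp [qFact_succ]; ring
    · intro s hs
      have : s ≠ i := by simpa using hs
      simp [this]
  have h0 : ∏ s, qFact q (a s) ≠ 0 := (Finset.prod_pos fun i _ => qFact_pos hq _).ne'
  have h1 := (qNum_pos hq (a i)).ne'
  rw [qMultinomial, qMultinomial, sum_add_single, h, qFact_succ]
  field_simp

theorem psiCoeff_sq {q : ℝ} (hq : q ∈ Set.Ioo (0 : ℝ) 1) {n : ℕ} (a : Fin (n + 1) → ℕ) :
    psiCoeff q a ^ 2 = qMultinomial q a *
      q ^ (((∑ i, (a i : ℝ)) ^ 2 - ∑ i, (a i : ℝ) ^ 2) / 2 +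
        2 * ∑ r : Fin (n + 1), ((r : ℕ) : ℝ) * (a r : ℝ)) := by
  rw [psiCoeff, mul_pow, Real.sq_sqrt (qMultinomial_nonneg hq a), ← Real.rpow_natCast,
    ← Real.rpow_mul hq.1.le, ← two_mul_sum_Iio_mul]
  congr 2
  push_cast
  ring

/-- Raising `a i` by one multiplies the `q`-multinomial by `[|a|+1]/[a_i+1]` and adds `|a| - a_i +
2i` to the exponent of `q`. The factors `q^{a_i+1}` and `q^{|a|+1}` absorb the part `|a| - a_i`. -/
theorem psiCoeff_sq_add_single {q : ℝ} (hq : q ∈ Set.Ioo (0 : ℝ) 1) {n : ℕ}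
    (a : Fin (n + 1) → ℕ) (i : Fin (n + 1)) :
    psiCoeff q (a + Pi.single i 1) ^ 2 * (qNum q (a i + 1) * q ^ (a i + 1)) =
      q ^ (2 * (i : ℕ)) * psiCoeff q a ^ 2 *
        (qNum q (∑ s, a s + 1) * q ^ (∑ s, a s + 1)) := by
  have hs : ∑ s, ((a + Pi.single i 1 : Fin (n + 1) → ℕ) s : ℝ) = ∑ s, (a s : ℝ) + 1 := by
    exact_mod_cast sum_add_single a i
  have hs2 : ∑ s, (((a + Pi.single i 1 : Fin (n + 1) → ℕ) s : ℕ) : ℝ) ^ 2 =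
      ∑ s, (a s : ℝ) ^ 2 + (2 * a i + 1) := by
    have (s : Fin (n + 1)) : (((a + Pi.single i 1 : Fin (n + 1) → ℕ) s : ℕ) : ℝ) ^ 2 =
        (a s : ℝ) ^ 2 + if s = i then (2 * (a i : ℝ) + 1) else 0 := by
      by_cases h : s = i
      · subst h; simp; ring
      · simp [h]
    rw [Finset.sum_congr rfl fun s _ => this s]
    simp [Finset.sum_add_distrib]
  have hr : ∑ r : Fin (n + 1), ((r : ℕ) : ℝ) * ((a + Pi.single i 1 : Fin (n + 1) → ℕ) r : ℕ) =
      ∑ r : Fin (n + 1), ((r : ℕ) : ℝ) * (a r : ℝ) + (i : ℕ) := by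
    have (r : Fin (n + 1)) : ((r : ℕ) : ℝ) * ((a + Pi.single i 1 : Fin (n + 1) → ℕ) r : ℕ) =
        ((r : ℕ) : ℝ) * (a r : ℝ) + if r = i then ((i : ℕ) : ℝ) else 0 := by
      by_cases h : r = i
      · subst h; simp; ring
      · simp [h]
    rw [Finset.sum_congr rfl fun s _ => this s]
    simp [Finset.sum_add_distrib]
  have hm := qMultinomial_add_single hq a i
  -- The exponents coming from `psiCoeff` are real, so the natural powers are compared with them as
  -- real powers.
  have key : ∀ A B : ℝ, A + ((a i + 1 : ℕ) : ℝ) =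
      ((2 * (i : ℕ) : ℕ) : ℝ) + B + ((∑ s, a s + 1 : ℕ) : ℝ) →
      q ^ A * q ^ (a i + 1) = q ^ (2 * (i : ℕ)) * q ^ B * q ^ (∑ s, a s + 1) := by
    intro A B h
    simp only [← Real.rpow_natCast q]
    rw [← Real.rpow_add hq.1, ← Real.rpow_add hq.1, ← Real.rpow_add hq.1, h]
  rw [psiCoeff_sq hq, psiCoeff_sq hq, hs, hs2, hr, mul_mul_mul_comm, hm, mul_assoc, key _
    (((∑ i, (a i : ℝ)) ^ 2 - ∑ i, (a i : ℝ) ^ 2) / 2 +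
        2 * ∑ r : Fin (n + 1), ((r : ℕ) : ℝ) * (a r : ℝ))]
  · ring
  · push_cast
    ring

/-- Each term on the left is split according to the weights `w a i / d`, which add up to `1` by
`sum_pow_mul_qNum`. The part with index `i` is the term on the right for `a - e_i` and `z_i`.
Leaving `G` abstract serves both `y^* y` and `y y^*`. -/
theorem sum_psiCoeff_sq_succ {q : ℝ} (hq : q ∈ Set.Ioo (0 : ℝ) 1) {n : ℕ} (N : ℕ)
    {M : Type*} [AddCommGroup M] [Module ℂ M] (G : SphereAlg q n → M)
    (hG : ∀ (r : ℝ) y, G ((r : ℂ) • y) = ((r ^ 2 : ℝ) : ℂ) • G y) :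
    ∑ a ∈ Finset.piAntidiag Finset.univ (N + 1), ((psiCoeff q a ^ 2 : ℝ) : ℂ) • G (monomial q a) =
      ∑ a ∈ Finset.piAntidiag Finset.univ N, ∑ i : Fin (n + 1),
        ((q ^ (2 * (i : ℕ)) * psiCoeff q a ^ 2 : ℝ) : ℂ) • G (zgen q i * monomial q a) := by
  set d : ℝ := qNum q (N + 1) * q ^ (N + 1) with hd
  have hd0 : d ≠ 0 := mul_ne_zero (qNum_pos hq N).ne' (pow_ne_zero _ hq.1.ne')
  let w (a : Fin (n + 1) → ℕ) (i : Fin (n + 1)) : ℝ :=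
    q ^ (2 * ∑ s, if s < i then a s else 0) * (qNum q (a i) * q ^ a i)
  -- Indices with `a i = 0` carry weight zero because `[0] = 0`. Dropping them makes `(a, i) ↦ (a +
  -- e_i, i)` a bijection onto the remaining pairs.
  have hL (a) (ha : a ∈ Finset.piAntidiag (Finset.univ : Finset (Fin (n + 1))) (N + 1)) :
      ((psiCoeff q a ^ 2 : ℝ) : ℂ) • G (monomial q a) =
        ∑ i with a i ≠ 0, ((w a i * psiCoeff q a ^ 2 / d : ℝ) : ℂ) • G (monomial q a) := by
    have ha' := (Finset.mem_piAntidiag.1 ha).1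
    have h := sum_pow_mul_qNum hq a
    rw [ha', ← hd] at h
    rw [Finset.sum_filter_of_ne, ← Finset.sum_smul, ← Complex.ofReal_sum, ← Finset.sum_div,
      ← Finset.sum_mul, h, mul_div_assoc, mul_div_cancel₀ _ hd0]
    intro i _ h h0
    apply h
    simp [w, h0, qNum_zero]
  rw [Finset.sum_congr rfl hL, Finset.sum_sigma', Finset.sum_sigma']
  symm
  refine Finset.sum_bij (fun x _ => ⟨x.1 + Pi.single x.2 1, x.2⟩) ?_ ?_ ?_ ?_
  · rintro ⟨a, i⟩ h
    simp only [Finset.mem_sigma, Finset.mem_piAntidiag, Finset.mem_univ, and_true,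
      Finset.mem_filter, true_and, implies_true] at h ⊢
    exact ⟨by rw [sum_add_single, h], by simp⟩
  · rintro ⟨a, i⟩ _ ⟨b, j⟩ _ h
    simp only [Sigma.mk.injEq, heq_eq_eq] at h
    obtain ⟨h, rfl⟩ := h
    rw [add_right_cancel h]
  · rintro ⟨a, i⟩ h
    simp only [Finset.mem_sigma, Finset.mem_piAntidiag, Finset.mem_univ, and_true,
      Finset.mem_filter, true_and, implies_true] at h
    have hs : a - Pi.single i 1 + Pi.single i 1 = a := by
      refine tsub_add_cancel_of_le fun s => ?_
      by_cases hs : s = i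
      · subst hs; simp; omega
      · simp [hs]
    refine ⟨⟨a - Pi.single i 1, i⟩, ?_, ?_⟩
    · simp only [Finset.mem_sigma, Finset.mem_piAntidiag, Finset.mem_univ, and_true,
        implies_true]
      have := sum_add_single (a - Pi.single i 1) i
      rw [hs] at this
      have h : ∑ s, a s = N + 1 := h.1
      change ∑ s, (a - Pi.single i 1 : Fin (n + 1) → ℕ) s = N
      omega
    · simp [hs]
  · rintro ⟨a, i⟩ h
    simp only [Finset.mem_sigma, Finset.mem_piAntidiag, Finset.mem_univ, and_true,
      implies_true] at h
    have hc := psiCoeff_sq_add_single hq a i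
    rw [h, ← hd] at hc
    have hsum : ∑ s, (if s < i then (a + Pi.single i 1 : Fin (n + 1) → ℕ) s else 0) =
        ∑ s, if s < i then a s else 0 := by
      refine Finset.sum_congr rfl fun s _ => ?_
      split_ifs with hs
      · simp [hs.ne]
      · rfl
    dsimp only
    rw [zgen_mul_monomial hq.1.ne', hG, smul_smul, ← Complex.ofReal_mul]
    congr 2
    simp only [w, hsum]
    rw [eq_div_iff hd0]
    have h1 : (a + Pi.single i 1 : Fin (n + 1) → ℕ) i = a i + 1 := by simp
    rw [h1]
    linear_combination (-(q ^ (2 * ∑ s, if s < i then a s else 0))) * hc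

theorem sum_star_psi_mul_psi {q : ℝ} (hq : q ∈ Set.Ioo (0 : ℝ) 1) {n : ℕ} (N : ℕ) :
    ∑ a ∈ Finset.piAntidiag (Finset.univ : Finset (Fin (n + 1))) N,
      ((psiCoeff q a ^ 2 : ℝ) : ℂ) • (star (monomial q a) * monomial q a) = 1 := by
  induction N with
  | zero =>
    simp [monomial, psiCoeff, qMultinomial, qFact, List.ofFn_const]
  | succ N ih =>
    rw [sum_psiCoeff_sq_succ hq N (fun y => star y * y)
      (fun r y => by rw [star_smul, smul_mul_smul_comm]; simp [sq]), ← ih]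
    refine Finset.sum_congr rfl fun a _ => ?_
    -- The identity `∑_i q^{2i} z_i^* z_i = 1` is inserted between the two monomials.
    have h : star (monomial q a) * monomial q a = star (monomial q a) *
        (∑ i : Fin (n + 1), ((q ^ (2 * (i : ℕ)) : ℝ) : ℂ) • (star (zgen q i) * zgen q i)) *
          monomial q a := by
      rw [q_trace, mul_one]
    rw [h, Finset.mul_sum, Finset.sum_mul, Finset.smul_sum]
    refine Finset.sum_congr rfl fun i _ => ?_
    rw [mul_smul_comm, smul_mul_assoc, smul_smul, star_mul, mul_comm (q ^ _),
      Complex.ofReal_mul]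
    simp only [mul_assoc]

/-! ### The projection property and the trace of `P_{-N}`. -/

theorem sum_multiIndex {M : Type*} [AddCommMonoid M] {n N : ℕ} (F : (Fin (n + 1) → ℕ) → M) :
    ∑ a : MultiIndex n N, F a.1 = ∑ a ∈ Finset.piAntidiag Finset.univ N, F a :=
  Finset.sum_coe_sort (Finset.piAntidiag Finset.univ N) F

theorem isStarProjection_projNeg {q : ℝ} (hq : q ∈ Set.Ioo (0 : ℝ) 1) (n N : ℕ) :
    IsStarProjection (projNeg hq n N) where
  isIdempotentElem := by
    refine Matrix.ext fun i j => Subtype.ext ?_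
    rw [Matrix.mul_apply, AddSubmonoidClass.coe_finsetSum]
    have h : ∑ l : MultiIndex n N, star (psiNeg q l) * psiNeg q l = 1 := by
      rw [← sum_star_psi_mul_psi hq N, ← sum_multiIndex]
      refine Finset.sum_congr rfl fun a _ => ?_
      rw [psiNeg, star_smul, smul_mul_smul_comm]
      simp [sq]
    have h' : ∀ l, ((projNeg hq n N i l * projNeg hq n N l j : projAlg q n) : SphereAlg q n) =
        psiNeg q i * (star (psiNeg q l) * psiNeg q l) * star (psiNeg q j) := fun l => by
      simp [projNeg, mul_assoc]
    rw [Finset.sum_congr rfl fun l _ => h' l, ← Finset.sum_mul, ← Finset.mul_sum, h, mul_one]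
    rfl
  isSelfAdjoint := by
    refine Matrix.ext fun i j => Subtype.ext ?_
    simp [projNeg]

theorem coe_trace_projNeg {q : ℝ} (hq : q ∈ Set.Ioo (0 : ℝ) 1) (n N : ℕ) :
    (((projNeg hq n N).trace : projAlg q n) : SphereAlg q n) =
      ∑ a ∈ Finset.piAntidiag Finset.univ N,
        ((psiCoeff q a ^ 2 : ℝ) : ℂ) • (monomial q a * star (monomial q a)) := by
  rw [Matrix.trace, AddSubmonoidClass.coe_finsetSum, ← sum_multiIndex]
  refine Finset.sum_congr rfl fun a _ => ?_
  change psiNeg q a * star (psiNeg q a) = _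
  rw [psiNeg, star_smul, smul_mul_smul_comm]
  simp [sq]

/-! ### The eigenvalues of the trace of the projections -/

/-- The eigenvalues of `Tr P_{-N}` in a representation in which `∑_{j ≥ i} z_j z_j^*` has the
eigenvalue `x i`. -/
def traceEigen (q : ℝ) (n : ℕ) : ℕ → (ℕ → ℝ) → ℝ
  | 0, _ => 1
  | N + 1, x => ∑ i ∈ Finset.range (n + 1), q ^ (2 * i) * (x i - x (i + 1)) *
      traceEigen q n N fun s => if i < s then (q ^ 2)⁻¹ * x s else x s

/-- Raising the entries at the places `i + 1, …, j` multiplies the corresponding `x s` by `q²`. The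
rescaling in `traceEigen` undoes exactly this, so it evaluates at the label before the shift. -/
theorem tailWeight_raise {q : ℝ} (hq : q ≠ 0) {k j : ℕ} (hj : j ≤ k) (i : ℕ) (m : Fin k → ℕ)
    (s : ℕ) : (if i < s then (q ^ 2)⁻¹ * tailWeight q j s (raise j i m)
      else tailWeight q j s (raise j i m)) = tailWeight q j s m := by
  simp only [tailWeight, coord_raise hj]
  by_cases h : i < s <;> by_cases h' : s ≤ j <;> simp [h, h', mul_add, pow_add]
  field_simp

theorem repOn_restrictHom_zgen {q : ℝ} (hq : q ∈ Set.Ioo (0 : ℝ) 1) {n k j : ℕ} (hk : k ≤ n)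
    (hj : j ≤ k) (i : Fin (n + 1)) :
    repOn hq hj (restrictHom q hk (zgen q i)) = zOp hq hj i := by
  rw [restrictHom, liftStar_z]
  by_cases h : (i : ℕ) < k + 1
  · rw [zext, dif_pos h]
    exact liftStar_z (sphereRelations_op hq hj) ⟨i, h⟩
  · rw [zext_of_lt q (by omega), map_zero, zOp_of_lt hq hj (by omega)]

/-- Induction through `T_{N+1} = ∑_i q^{2i} z_i T_N z_i^*`: at a label `m' + ε_i` the inner `T_N` is
evaluated at `m'`, and what remains is the eigenvalue `x_i - x_{i+1}` of `z_i z_i^*`. -/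
theorem repOn_restrictHom_trace {q : ℝ} (hq : q ∈ Set.Ioo (0 : ℝ) 1) {n k j : ℕ} (hk : k ≤ n)
    (hj : j ≤ k) (N : ℕ) (f : lp (fun _ : Label k j => ℂ) 2) (m : Label k j) :
    repOn hq hj (restrictHom q hk (∑ a ∈ Finset.piAntidiag Finset.univ N,
      ((psiCoeff q a ^ 2 : ℝ) : ℂ) • (monomial q a * star (monomial q a)))) f m =
      (traceEigen q n N (fun s => tailWeight q j s m.1) : ℂ) * f m := by
  induction N generalizing f m with
  | zero =>
    simp [monomial, psiCoeff, qMultinomial, qFact, List.ofFn_const, traceEigen]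
  | succ N ih =>
    rw [sum_psiCoeff_sq_succ hq N (fun y => y * star y)
      (fun r y => by rw [star_smul, smul_mul_smul_comm]; simp [sq]), Finset.sum_comm]
    set S : SphereAlg q n := ∑ a ∈ Finset.piAntidiag Finset.univ N,
      ((psiCoeff q a ^ 2 : ℝ) : ℂ) • (monomial q a * star (monomial q a)) with hS
    have h : ∀ i : Fin (n + 1), ∑ a ∈ Finset.piAntidiag Finset.univ N,
        ((q ^ (2 * (i : ℕ)) * psiCoeff q a ^ 2 : ℝ) : ℂ) •
          (zgen q i * monomial q a * star (zgen q i * monomial q a)) =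
        ((q ^ (2 * (i : ℕ)) : ℝ) : ℂ) • (zgen q i * S * star (zgen q i)) := by
      intro i
      rw [hS, Finset.mul_sum, Finset.sum_mul, Finset.smul_sum]
      refine Finset.sum_congr rfl fun a _ => ?_
      rw [mul_smul_comm, smul_mul_assoc, smul_smul, star_mul, Complex.ofReal_mul]
      simp only [mul_assoc]
    rw [Finset.sum_congr rfl fun i _ => h i, map_sum, map_sum, _root_.sum_apply, lp.coeFn_sum,
      Finset.sum_apply, traceEigen, ← Fin.sum_univ_eq_sum_range
        (fun i => q ^ (2 * i) * (tailWeight q j i m.1 - tailWeight q j (i + 1) m.1) *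
          traceEigen q n N fun s => if i < s then (q ^ 2)⁻¹ * tailWeight q j s m.1
            else tailWeight q j s m.1), Complex.ofReal_sum, Finset.sum_mul]
    refine Finset.sum_congr rfl fun i _ => ?_
    have hstar : star (zOp hq hj i) = zsOp hq hj i :=
      ContinuousLinearMap.adjoint_adjoint (zsOp hq hj i)
    rw [map_smul, map_smul, map_mul, map_mul, map_mul, map_mul, map_star, map_star,
      repOn_restrictHom_zgen, hstar]
    change ((q ^ (2 * (i : ℕ)) : ℝ) : ℂ) * (zOp hq hj i
      (repOn hq hj (restrictHom q hk S) (zsOp hq hj i f))) m = _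
    have hz := zOp_zsOp_apply hq hj i f m
    change zOp hq hj i (zsOp hq hj i f) m = _ at hz
    by_cases hm : ∃ m', raiseLabel hj i m' = m
    · obtain ⟨m', rfl⟩ := hm
      simp only [raiseLabel, tailWeight_raise hq.1.ne' hj]
      rw [zOp_apply] at hz
      have hz' := zOp_apply hq hj i (repOn hq hj (restrictHom q hk S) (zsOp hq hj i f)) m'
      rw [ih] at hz'
      simp only [raiseLabel] at hz hz'
      rw [hz']
      push_cast at hz ⊢
      linear_combination (q : ℂ) ^ (2 * (i : ℕ)) *
        (traceEigen q n N (fun s => tailWeight q j s m'.1) : ℂ) * hz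
    -- Outside the range of the shift `z_i` both sides vanish: `hz` becomes `(x_i - x_{i+1}) f m =
    -- 0`.
    · push Not at hm
      rw [zOp_apply_of_notMem hq hj i _ _ hm] at hz ⊢
      push_cast at hz ⊢
      linear_combination (q : ℂ) ^ (2 * (i : ℕ)) * (traceEigen q n N (fun s => if (i : ℕ) < s
        then (q ^ 2)⁻¹ * tailWeight q j s m.1 else tailWeight q j s m.1) : ℂ) * hz

open Classical in
theorem piRep_restrictHom_trace {q : ℝ} (hq : q ∈ Set.Ioo (0 : ℝ) 1) {n k j : ℕ} (hk : k ≤ n)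
    (hj : j ≤ k) (N : ℕ) (f : HilbN k) (m : Fin k → ℕ) :
    piRep hq hj (restrictHom q hk ((projNeg hq n N).trace : projAlg q n)) f m =
      ((if Admissible j m then traceEigen q n N (fun s => tailWeight q j s m) else 0 : ℝ) : ℂ) *
        f m := by
  rw [coe_trace_projNeg]
  change ContinuousLinearMap.adjoint (restrictLabel k j) (repOn hq hj (restrictHom q hk _)
    (restrictLabel k j f)) m = _
  split_ifs with h
  · refine (adjoint_weightedComp_apply (w := fun _ => 1) Subtype.val_injective (by simp) _
        (⟨m, h⟩ : Label k j)).trans ?_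
    rw [repOn_restrictHom_trace]
    have : restrictLabel k j f ⟨m, h⟩ = ((1 : ℝ) : ℂ) * f m := rfl
    rw [this]
    simp
  · refine (adjoint_weightedComp_apply_of_notMem (w := fun _ => 1) Subtype.val_injective
        (by simp) _ m (fun l hl => h (hl ▸ l.2))).trans ?_
    simp

open Classical in
/-- The eigenvalues of `(π_+^{(k)} - π_-^{(k)})(a)` for an element `a` that acts in the
representations `π_j^{(k)}` by the function `f` of the eigenvalues of `∑_{j ≥ i} z_j z_j^*`. -/
def pairingEigen (q : ℝ) (f : (ℕ → ℝ) → ℝ) {k : ℕ} (m : Fin k → ℕ) : ℝ :=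
  ∑ j ∈ Finset.range (k + 1),
    (-1) ^ j * if Admissible j m then f (fun s => tailWeight q j s m) else 0

theorem pairingOperator_apply {q : ℝ} (hq : q ∈ Set.Ioo (0 : ℝ) 1) {n k : ℕ} (hk : k ≤ n)
    (N : ℕ) (f : HilbN k) (m : Fin k → ℕ) :
    pairingOperator hq hk (projNeg hq n N) f m = (pairingEigen q (traceEigen q n N) m : ℂ) * f m := by
  classical
  rw [pairingOperator, piPlus, piMinus, ← Finset.sum_sub_distrib, _root_.sum_apply, lp.coeFn_sum,
    Finset.sum_apply, pairingEigen, ← Fin.sum_univ_eq_sum_range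
      (fun j => (-1) ^ j * if Admissible j m then
        traceEigen q n N (fun s => tailWeight q j s m) else 0), Complex.ofReal_sum, Finset.sum_mul]
  refine Finset.sum_congr rfl fun j _ => ?_
  have h := piRep_restrictHom_trace hq hk (Nat.lt_succ_iff.1 j.2) N f m
  rw [Complex.ofReal_mul, mul_assoc]
  rcases Nat.even_or_odd (j : ℕ) with hj | hj
  · rw [if_pos hj, if_neg (Nat.not_odd_iff_even.2 hj), sub_zero, hj.neg_one_pow, h]
    simp
  · rw [if_neg (Nat.not_even_iff_odd.2 hj), if_pos hj, zero_sub, hj.neg_one_pow, neg_apply,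
      lp.coeFn_neg, Pi.neg_apply, h]
    simp

/-! ### Diagonal operators of trace class -/

/-- The positive square root of `T^* T` is unique, so `E` is `|T|`. -/
theorem isTraceClass_of_mul_self_eq {H : Type} [NormedAddCommGroup H] [InnerProductSpace ℂ H]
    [CompleteSpace H] {T E : H →L[ℂ] H} (hT : IsSelfAdjoint T) (hE : E.IsPositive)
    (h : E * E = T * T)
    (hs : ∀ (ι : Type) (b : HilbertBasis ι ℂ H), Summable fun i => inner ℂ (b i) (E (b i))) :
    IsTraceClass T := by
  have : CFC.abs T = E := CFC.sqrt_unique (by rw [hT.star_eq, h])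
    ((ContinuousLinearMap.nonneg_iff_isPositive _).2 hE)
  rwa [IsTraceClass, this]

section Diagonal

variable {κ : Type} {D : lp (fun _ : κ => ℂ) 2 →L[ℂ] lp (fun _ : κ => ℂ) 2} {c : κ → ℝ}

/-- Here `⟨b_i, D b_i⟩ = ∑_m c_m |b_i(m)|²`, and Parseval for the `m`-th unit vector gives `∑_i
|b_i(m)|² = 1`. Absolute summability of `c` allows the two sums to be exchanged, whatever the basis.
-/
theorem hasSum_inner_diagonal (hD : ∀ f m, D f m = c m * f m) (hc : Summable fun m => |c m|)
    {ι : Type} (b : HilbertBasis ι ℂ (lp (fun _ : κ => ℂ) 2)) :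
    HasSum (fun i => inner ℂ (b i) (D (b i))) ((∑' m, c m : ℝ) : ℂ) := by
  classical
  have h1 : ∀ m, HasSum (fun i => ‖b i m‖ ^ 2) 1 := by
    intro m
    have h := b.hasSum_inner_mul_inner (lp.single 2 m (1 : ℂ)) (lp.single 2 m (1 : ℂ))
    simp only [lp.inner_single_left, lp.inner_single_right, RCLike.inner_apply, map_one, mul_one,
      one_mul, lp.single_apply_self, Complex.mul_conj'] at h
    rw [← Complex.ofReal_one] at h
    exact_mod_cast h
  let F : κ × ι → ℝ := fun p => c p.1 * ‖b p.2 p.1‖ ^ 2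
  have hF : Summable F := by
    refine Summable.of_norm ((summable_prod_of_nonneg fun p => norm_nonneg _).2 ⟨fun m => ?_, ?_⟩)
    · simpa [F] using (h1 m).summable.mul_left |c m|
    · refine hc.congr fun m => ?_
      have := ((h1 m).mul_left |c m|).tsum_eq
      simpa [F] using this.symm
  have hs1 := hF.hasSum.prod_fiberwise (fun m => (h1 m).mul_left (c m))
  simp only [mul_one] at hs1
  rw [hs1.tsum_eq]
  have hs2 := (Equiv.prodComm ι κ).hasSum_iff.2 hF.hasSum
  have hinner : ∀ i, HasSum (fun m => ((c m * ‖b i m‖ ^ 2 : ℝ) : ℂ))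
      (inner ℂ (b i) (D (b i))) := by
    intro i
    rw [show (fun m => ((c m * ‖b i m‖ ^ 2 : ℝ) : ℂ)) =
      fun m => inner ℂ (b i m) (D (b i) m) from ?_]
    · exact lp.hasSum_inner (b i) (D (b i))
    ext m
    rw [hD, RCLike.inner_apply, mul_assoc, Complex.mul_conj']
    push_cast
    ring
  have hre : ∀ i, HasSum (fun m => c m * ‖b i m‖ ^ 2) (inner ℂ (b i) (D (b i))).re :=
    fun i => by simpa only [Complex.ofReal_re] using Complex.hasSum_re (hinner i)
  have hs3 := (hs2.prod_fiberwise hre)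
  have him : ∀ i, inner ℂ (b i) (D (b i)) = (((inner ℂ (b i) (D (b i))).re : ℝ) : ℂ) :=
    fun i => (hinner i).unique (by exact_mod_cast Complex.hasSum_ofReal.2 (hre i))
  rw [funext him]
  exact Complex.hasSum_ofReal.2 hs3

theorem isPositive_diagonal (hD : ∀ f m, D f m = c m * f m) (hc : ∀ m, 0 ≤ c m) :
    D.IsPositive := by
  rw [ContinuousLinearMap.isPositive_iff_complex]
  intro f
  have h : HasSum (fun m => ((c m * ‖f m‖ ^ 2 : ℝ) : ℂ)) (inner ℂ (D f) f) := by
    rw [show (fun m => ((c m * ‖f m‖ ^ 2 : ℝ) : ℂ)) = fun m => inner ℂ (D f m) (f m) from ?_]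
    · exact lp.hasSum_inner (D f) f
    ext m
    rw [hD, RCLike.inner_apply, map_mul, Complex.conj_ofReal, mul_left_comm, Complex.mul_conj']
    push_cast
    ring
  have hre : HasSum (fun m => c m * ‖f m‖ ^ 2) (inner ℂ (D f) f).re := by
    simpa only [Complex.ofReal_re] using Complex.hasSum_re h
  exact ⟨(Complex.hasSum_ofReal.2 hre).unique h,
    hre.nonneg fun m => mul_nonneg (hc m) (sq_nonneg _)⟩

theorem isSelfAdjoint_diagonal (hD : ∀ f m, D f m = c m * f m) : IsSelfAdjoint D := by
  rw [ContinuousLinearMap.isSelfAdjoint_iff_isSymmetric]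
  intro f g
  change inner ℂ (D f) g = inner ℂ f (D g)
  rw [lp.inner_eq_tsum, lp.inner_eq_tsum]
  refine tsum_congr fun m => ?_
  rw [hD, hD, RCLike.inner_apply, RCLike.inner_apply, map_mul, Complex.conj_ofReal]
  ring

theorem exists_diagonal {C : ℝ} (hc : ∀ m, |c m| ≤ C) :
    ∃ E : lp (fun _ : κ => ℂ) 2 →L[ℂ] lp (fun _ : κ => ℂ) 2, ∀ f m, E f m = c m * f m := by
  -- `weightedComp` needs weights bounded by `1`; dividing by `|C| + 1` rather than `C` keeps the
  -- divisor positive.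
  have h : ∀ m, |c m / (|C| + 1)| ≤ 1 := fun m => by
    rw [abs_div, abs_of_pos (by positivity : 0 < |C| + 1), div_le_one (by positivity)]
    linarith [hc m, le_abs_self C]
  refine ⟨((|C| + 1 : ℝ) : ℂ) • weightedComp (fun m => c m / (|C| + 1)) id
    Function.injective_id h, fun f m => ?_⟩
  change ((|C| + 1 : ℝ) : ℂ) * (((c m / (|C| + 1) : ℝ) : ℂ) * f m) = _
  rw [← mul_assoc, ← Complex.ofReal_mul, mul_div_cancel₀ _ (by positivity)]

theorem hasTrace_diagonal (hD : ∀ f m, D f m = c m * f m) (hc : Summable fun m => |c m|) :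
    HasTrace D ((∑' m, c m : ℝ) : ℂ) := by
  obtain ⟨E, hE⟩ := exists_diagonal (c := fun m => |c m|) (C := ∑' m, |c m|)
    (by simpa using fun m => hc.le_tsum m fun _ _ => abs_nonneg _)
  refine ⟨isTraceClass_of_mul_self_eq (isSelfAdjoint_diagonal hD)
    (isPositive_diagonal hE fun m => abs_nonneg _) ?_ fun ι b =>
      (hasSum_inner_diagonal hE (by simpa using hc) b).summable,
    fun ι b => hasSum_inner_diagonal hD hc b⟩
  ext f m
  change E (E f) m = D (D f) m
  rw [hE, hE, hD, hD, ← mul_assoc, ← mul_assoc, ← Complex.ofReal_mul, ← Complex.ofReal_mul,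
    abs_mul_abs_self]

end Diagonal

/-! ### Bounds for the eigenvalues -/

/-- A function of real sequences that is bounded on bounded sets, and that changes by at most a
multiple of `|x j|` if `x j` is replaced by `0`. -/
def LipschitzAtZero (f : (ℕ → ℝ) → ℝ) : Prop :=
  ∀ R : ℝ, ∃ C : ℝ, ∀ x : ℕ → ℝ, (∀ s, |x s| ≤ R) →
    |f x| ≤ C ∧ ∀ j, |f x - f (Function.update x j 0)| ≤ C * |x j|

theorem abs_update_zero_le {x : ℕ → ℝ} {R : ℝ} (hx : ∀ s, |x s| ≤ R) (j s : ℕ) :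
    |Function.update x j 0 s| ≤ R := by
  rcases eq_or_ne s j with rfl | h
  · simpa using (abs_nonneg _).trans (hx s)
  · simpa [h] using hx s

namespace LipschitzAtZero

variable {f g : (ℕ → ℝ) → ℝ}

protected theorem const (c : ℝ) : LipschitzAtZero fun _ => c := fun R =>
  ⟨|c|, fun x _ => ⟨le_rfl, fun j => by simpa using by positivity⟩⟩

protected theorem eval (i : ℕ) : LipschitzAtZero fun x => x i := fun R =>
  ⟨max R 1, fun x hx => ⟨(hx i).trans (le_max_left _ _), fun j => by
    have h1 := le_mul_of_one_le_left (abs_nonneg (x j)) (le_max_right R 1)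
    rcases eq_or_ne i j with rfl | h
    · simpa using h1
    · simpa only [Function.update_of_ne h, sub_self, abs_zero] using (abs_nonneg _).trans h1⟩⟩

protected theorem add (hf : LipschitzAtZero f) (hg : LipschitzAtZero g) :
    LipschitzAtZero fun x => f x + g x := fun R => by
  obtain ⟨C, hC⟩ := hf R
  obtain ⟨D, hD⟩ := hg R
  refine ⟨C + D, fun x hx => ⟨(abs_add_le _ _).trans (add_le_add (hC x hx).1 (hD x hx).1),
    fun j => ?_⟩⟩
  rw [add_sub_add_comm, add_mul]
  exact (abs_add_le _ _).trans (add_le_add ((hC x hx).2 j) ((hD x hx).2 j))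

protected theorem mul (hf : LipschitzAtZero f) (hg : LipschitzAtZero g) :
    LipschitzAtZero fun x => f x * g x := fun R => by
  obtain ⟨C, hC⟩ := hf R
  obtain ⟨D, hD⟩ := hg R
  refine ⟨2 * (C * D), fun x hx => ?_⟩
  have hC0 := (abs_nonneg _).trans (hC x hx).1
  have hD0 := (abs_nonneg _).trans (hD x hx).1
  constructor
  · rw [abs_mul]
    have := mul_le_mul (hC x hx).1 (hD x hx).1 (abs_nonneg _) hC0
    linarith [mul_nonneg hC0 hD0]
  · intro j
    set y := Function.update x j 0
    have hy := hD y (abs_update_zero_le hx j)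
    calc |f x * g x - f y * g y| = |f x * (g x - g y) + (f x - f y) * g y| := by
          congr 1; ring
      _ ≤ |f x| * |g x - g y| + |f x - f y| * |g y| := by
          rw [← abs_mul, ← abs_mul]; exact abs_add_le _ _
      _ ≤ C * (D * |x j|) + C * |x j| * D :=
          add_le_add (mul_le_mul (hC x hx).1 ((hD x hx).2 j) (abs_nonneg _) hC0)
            (mul_le_mul ((hC x hx).2 j) hy.1 (abs_nonneg _)
              (mul_nonneg hC0 (abs_nonneg _)))
      _ = 2 * (C * D) * |x j| := by ring

protected theorem sum {ι : Type*} (s : Finset ι) {f : ι → (ℕ → ℝ) → ℝ}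
    (hf : ∀ i ∈ s, LipschitzAtZero (f i)) : LipschitzAtZero fun x => ∑ i ∈ s, f i x := by
  classical
  induction s using Finset.induction_on with
  | empty => simpa using LipschitzAtZero.const 0
  | insert a s ha ih =>
    simp only [Finset.sum_insert ha]
    exact (hf a (Finset.mem_insert_self a s)).add
      (ih fun i hi => hf i (Finset.mem_insert_of_mem hi))

/-- Rescaling coordinates commutes with setting one of them to `0`, and it maps sequences bounded by
`R` to sequences bounded by `(|c| + 1) R`. -/
theorem comp_scale (hf : LipschitzAtZero f) (i : ℕ) (c : ℝ) :
    LipschitzAtZero fun x => f fun s => if i < s then c * x s else x s := fun R => by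
  obtain ⟨C, hC⟩ := hf ((|c| + 1) * R)
  have hle : ∀ (x : ℕ → ℝ) s, |if i < s then c * x s else x s| ≤ (|c| + 1) * |x s| := by
    intro x s
    split_ifs
    · rw [abs_mul]
      exact mul_le_mul_of_nonneg_right (by linarith) (abs_nonneg _)
    · exact le_mul_of_one_le_left (abs_nonneg _) (by linarith [abs_nonneg c])
  refine ⟨C * (|c| + 1), fun x hx => ?_⟩
  have hx' := hC (fun s => if i < s then c * x s else x s) fun s =>
    (hle x s).trans (mul_le_mul_of_nonneg_left (hx s) (by positivity))
  have hC0 := (abs_nonneg _).trans hx'.1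
  refine ⟨hx'.1.trans (le_mul_of_one_le_right hC0 (by linarith [abs_nonneg c])), fun j => ?_⟩
  have hu : (fun s => if i < s then c * Function.update x j 0 s else Function.update x j 0 s) =
      Function.update (fun s => if i < s then c * x s else x s) j 0 := by
    ext s
    rcases eq_or_ne s j with rfl | h
    · simp
    · simp [h]
  dsimp only
  rw [hu, mul_assoc]
  exact (hx'.2 j).trans (mul_le_mul_of_nonneg_left (hle x j) hC0)

end LipschitzAtZero

theorem lipschitzAtZero_traceEigen (q : ℝ) (n N : ℕ) : LipschitzAtZero (traceEigen q n N) := by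
  induction N with
  | zero => exact LipschitzAtZero.const 1
  | succ N ih =>
    refine LipschitzAtZero.sum _ fun i _ => LipschitzAtZero.mul ?_ (ih.comp_scale i _)
    have := (LipschitzAtZero.const (q ^ (2 * i))).mul ((LipschitzAtZero.eval i).add
      ((LipschitzAtZero.const (-1)).mul (LipschitzAtZero.eval (i + 1))))
    simpa only [neg_one_mul, ← sub_eq_add_neg] using this

/-! ### Admissible labels -/

theorem Admissible.coord_mono {k j : ℕ} {m : Fin k → ℕ} (h : Admissible j m) {s t : ℕ}
    (hst : s ≤ t) (ht : t ≤ j) : coord m s ≤ coord m t := by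
  induction t, hst using Nat.le_induction with
  | base => exact le_rfl
  | succ t _ ih => exact (ih (by omega)).trans (h.1 t (by omega))

theorem coord_of_lt {k : ℕ} (m : Fin k → ℕ) {s : ℕ} (h : k < s) : coord m s = 0 := by
  cases s with
  | zero => rfl
  | succ s => exact dif_neg (by omega)

theorem Admissible.coord_anti {k j : ℕ} {m : Fin k → ℕ} (h : Admissible j m) {s t : ℕ}
    (hs : j + 1 ≤ s) (hst : s ≤ t) : coord m t ≤ coord m s := by
  induction t, hst using Nat.le_induction with
  | base => exact le_rfl
  | succ t hst ih =>
    rcases lt_or_ge t k with ht | ht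
    · exact (h.2 t (by omega) ht).le.trans ih
    · rw [coord_of_lt m (by omega)]; exact Nat.zero_le _

/-- A label `m` that is admissible for some `j` increases up to a peak at a place `a`, and it is
then admissible for `a` and `a - 1` only. -/
theorem Admissible.exists_peak {k j : ℕ} {m : Fin k → ℕ} (hk : 0 < k) (hj : j ≤ k)
    (h : Admissible j m) : ∃ b < k, (∀ i ≤ k, Admissible i m ↔ i = b ∨ i = b + 1) ∧
      ∀ s, coord m s ≤ coord m (b + 1) := by
  obtain ⟨b, hb, h0, h1⟩ : ∃ b < k, Admissible b m ∧ Admissible (b + 1) m := by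
    -- If the step after place `j` does not descend, `m` is also admissible for `j + 1`. Otherwise
    -- it is also admissible for `j - 1`; here `j = 0` is excluded because `m_0 = 0`.
    by_cases hc : j < k ∧ coord m j ≤ coord m (j + 1)
    · refine ⟨j, hc.1, h, fun i hi => ?_, fun i hi hi' => h.2 i (by omega) hi'⟩
      rcases Nat.lt_succ_iff_lt_or_eq.1 hi with hi | rfl
      · exact h.1 i hi
      · exact hc.2
    · cases j with
      | zero => exact absurd ⟨hk, Nat.zero_le _⟩ hc
      | succ j =>
        refine ⟨j, by omega, ⟨fun i hi => h.1 i (by omega), fun i hi hi' => ?_⟩, h⟩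
        rcases hi.eq_or_lt with rfl | hi
        · exact not_le.1 fun hle => hc ⟨hi', hle⟩
        · exact h.2 i (by omega) hi'
  refine ⟨b, hb, fun i hi => ⟨fun h' => ?_, ?_⟩, fun s => ?_⟩
  · by_contra hne
    push Not at hne
    -- A smaller `i` would force `m_{b+1} < m_b`, a larger one `m_{b+1} ≤ m_{b+2}`. Both contradict
    -- admissibility for `b + 1` or for `b`.
    rcases lt_or_ge i b with hib | hib
    · have := h'.2 b (by omega) hb
      have := h1.1 b (by omega)
      omega
    · have := h'.1 (b + 1) (by omega)
      have := h0.2 (b + 1) le_rfl (by omega)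
      omega
  · rintro (rfl | rfl)
    · exact h0
    · exact h1
  · rcases le_total s (b + 1) with hs | hs
    · exact h1.coord_mono hs le_rfl
    · exact h0.coord_anti le_rfl hs

/-- This is what links the two neighbouring representations at a peak to `LipschitzAtZero`. -/
theorem update_tailWeight (q : ℝ) {k : ℕ} (b : ℕ) (m : Fin k → ℕ) :
    Function.update (fun s => tailWeight q (b + 1) s m) (b + 1) 0 =
      fun s => tailWeight q b s m := by
  ext s
  rcases eq_or_ne s (b + 1) with rfl | h
  · simp [tailWeight]
  · simp only [Function.update_of_ne h, tailWeight]
    split_ifs <;> first | rfl | omega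

theorem pairingEigen_eq (q : ℝ) (f : (ℕ → ℝ) → ℝ) {k : ℕ} (hk : 0 < k) (m : Fin k → ℕ) :
    pairingEigen q f m = 0 ∨ ∃ b < k, (∀ s, coord m s ≤ coord m (b + 1)) ∧
      pairingEigen q f m = (-1) ^ (b + 1) * (f (fun s => tailWeight q (b + 1) s m) -
        f (Function.update (fun s => tailWeight q (b + 1) s m) (b + 1) 0)) := by
  classical
  by_cases h : ∃ j ≤ k, Admissible j m
  · obtain ⟨j, hj, h⟩ := h
    obtain ⟨b, hb, hadm, hmax⟩ := h.exists_peak hk hj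
    refine Or.inr ⟨b, hb, hmax, ?_⟩
    rw [pairingEigen, ← Finset.sum_subset (s₁ := {b, b + 1})]
    · rw [Finset.sum_pair (by omega), if_pos ((hadm b hb.le).2 (Or.inl rfl)),
        if_pos ((hadm (b + 1) hb).2 (Or.inr rfl)), update_tailWeight]
      ring
    · intro i hi
      simp only [Finset.mem_insert, Finset.mem_singleton] at hi
      rw [Finset.mem_range]
      omega
    · intro i hi hi'
      simp only [Finset.mem_insert, Finset.mem_singleton] at hi'
      rw [if_neg fun h => hi' ((hadm i (by simpa [Nat.lt_succ_iff] using hi)).1 h), mul_zero]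
  · push Not at h
    refine Or.inl (Finset.sum_eq_zero fun j hj => ?_)
    rw [if_neg (h j (by simpa [Nat.lt_succ_iff] using hj)), mul_zero]

theorem abs_tailWeight_le {q : ℝ} (hq : q ∈ Set.Ioo (0 : ℝ) 1) {k : ℕ} (j s : ℕ)
    (m : Fin k → ℕ) : |tailWeight q j s m| ≤ 1 := by
  rw [tailWeight]
  split_ifs
  · rw [abs_of_nonneg (pow_nonneg hq.1.le _)]
    exact pow_le_one₀ hq.1.le hq.2.le
  · simp

/-! ### Summability of the eigenvalues -/

/-- The multi-indices with all entries at most `M`. -/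
def box (k M : ℕ) : Finset (Fin k → ℕ) := Fintype.piFinset fun _ => Finset.range (M + 1)

theorem mem_box {k M : ℕ} {m : Fin k → ℕ} : m ∈ box k M ↔ ∀ s, coord m s ≤ M := by
  simp only [box, Fintype.mem_piFinset, Finset.mem_range, Nat.lt_succ_iff]
  constructor
  · intro h s
    cases s with
    | zero => exact Nat.zero_le _
    | succ s =>
      rw [coord]
      split_ifs
      · exact h _
      · exact Nat.zero_le _
  · intro h r
    simpa [coord] using h (r + 1)

theorem tendsto_box (k : ℕ) : Filter.Tendsto (box k) Filter.atTop Filter.atTop := by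
  refine Filter.tendsto_atTop_finset_of_monotone (fun M M' h m hm => ?_) fun m => ?_
  · rw [mem_box] at hm ⊢
    exact fun s => (hm s).trans h
  · refine ⟨∑ r, m r, ?_⟩
    simp only [box, Fintype.mem_piFinset, Finset.mem_range, Nat.lt_succ_iff]
    exact fun r => Finset.single_le_sum (fun _ _ => Nat.zero_le _) (Finset.mem_univ r)

theorem summable_prod_pow {r : ℝ} (h0 : 0 ≤ r) (h1 : r < 1) (k : ℕ) :
    Summable fun m : Fin k → ℕ => ∏ i, r ^ m i := by
  refine summable_of_sum_le (c := ((1 - r)⁻¹) ^ k)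
    (fun m => Finset.prod_nonneg fun i _ => pow_nonneg h0 _) fun u => ?_
  obtain ⟨M, hM⟩ := Filter.eventually_atTop.1
    ((tendsto_box k).eventually (Filter.eventually_ge_atTop u))
  calc ∑ m ∈ u, ∏ i, r ^ m i ≤ ∑ m ∈ box k M, ∏ i, r ^ m i :=
        Finset.sum_le_sum_of_subset_of_nonneg (hM M le_rfl)
          fun m _ _ => Finset.prod_nonneg fun i _ => pow_nonneg h0 _
    _ = ∏ _i : Fin k, ∑ t ∈ Finset.range (M + 1), r ^ t :=
        (Finset.prod_univ_sum (fun _ => Finset.range (M + 1)) fun _ t => r ^ t).symm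
    _ ≤ ∏ _i : Fin k, (1 - r)⁻¹ := Finset.prod_le_prod
        (fun _ _ => Finset.sum_nonneg fun _ _ => pow_nonneg h0 _) fun _ _ =>
          (tsum_geometric_of_lt_one h0 h1) ▸
            (summable_geometric_of_lt_one h0 h1).sum_le_tsum _ fun _ _ => pow_nonneg h0 _
    _ = ((1 - r)⁻¹) ^ k := by simp

/-- The eigenvalue is at most `C q^{2 max m}`. With `r = q^{2/k}` this is `C r^{k max m} ≤ C ∏_i
r^{m_i}`, a product of geometric series. -/
theorem summable_abs_pairingEigen {q : ℝ} (hq : q ∈ Set.Ioo (0 : ℝ) 1) {f : (ℕ → ℝ) → ℝ}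
    (hf : LipschitzAtZero f) (k : ℕ) :
    Summable fun m : Fin k → ℕ => |pairingEigen q f m| := by
  rcases Nat.eq_zero_or_pos k with rfl | hk
  · exact (hasSum_fintype _).summable
  obtain ⟨C, hC⟩ := hf 1
  have hC0 : 0 ≤ C := (abs_nonneg _).trans (hC (fun _ => 0) (by simp)).1
  set r : ℝ := (q ^ 2) ^ ((k : ℝ)⁻¹) with hr
  have hr0 : 0 ≤ r := by positivity
  have hrk : r ^ k = q ^ 2 := Real.rpow_inv_natCast_pow (sq_nonneg q) hk.ne'
  have hr1 : r < 1 := Real.rpow_lt_one (sq_nonneg q) (pow_lt_one₀ hq.1.le hq.2 two_ne_zero)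
    (by positivity)
  refine Summable.of_nonneg_of_le (fun m => abs_nonneg _) (fun m => ?_)
    ((summable_prod_pow hr0 hr1 k).mul_left C)
  have hp : 0 ≤ ∏ i, r ^ m i := Finset.prod_nonneg fun i _ => pow_nonneg hr0 _
  rcases pairingEigen_eq q f hk m with h | ⟨b, hb, hmax, h⟩
  · rw [h, abs_zero]
    exact mul_nonneg hC0 hp
  · rw [h, abs_mul, abs_pow, abs_neg, abs_one, one_pow, one_mul]
    refine ((hC _ fun s => abs_tailWeight_le hq _ s m).2 (b + 1)).trans
      (mul_le_mul_of_nonneg_left ?_ hC0)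
    rw [tailWeight, if_pos le_rfl, abs_of_nonneg (pow_nonneg hq.1.le _), pow_mul, ← hrk,
      ← pow_mul, Finset.prod_pow_eq_pow_sum]
    refine pow_le_pow_of_le_one hr0 hr1.le ?_
    calc ∑ i, m i ≤ ∑ _i : Fin k, coord m (b + 1) :=
          Finset.sum_le_sum fun i _ => by simpa [coord] using hmax (i + 1)
      _ = k * coord m (b + 1) := by simp

/-! ### Truncated traces -/

open Classical in
/-- The labels of `V_j^k` with entries at most `M`. -/
def labelBox (k j M : ℕ) : Finset (Fin k → ℕ) := {m ∈ box k M | Admissible j m}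

theorem mem_labelBox {k j M : ℕ} {m : Fin k → ℕ} :
    m ∈ labelBox k j M ↔ (∀ s, coord m s ≤ M) ∧ Admissible j m := by
  simp only [labelBox, Finset.mem_filter, mem_box]

theorem card_labelBox_le (k j M : ℕ) : (labelBox k j M).card ≤ (M + 1) ^ k :=
  (Finset.card_le_card fun _ hm => mem_box.2 (mem_labelBox.1 hm).1).trans
    (by simp [box] : (box k M).card ≤ _)

theorem sum_box_pairingEigen (q : ℝ) (f : (ℕ → ℝ) → ℝ) (k M : ℕ) :
    ∑ m ∈ box k M, pairingEigen q f m =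
      ∑ j ∈ Finset.range (k + 1),
        (-1) ^ j * ∑ m ∈ labelBox k j M, f (fun s => tailWeight q j s m) := by
  classical
  simp only [pairingEigen, labelBox]
  rw [Finset.sum_comm]
  refine Finset.sum_congr rfl fun j _ => ?_
  rw [← Finset.mul_sum, Finset.sum_filter]

/-- Reindexing by `m ↦ m + ε_i`. The labels of the box outside the image have `m_i = m_{i+1}`, so
their terms vanish. The condition on the right says that the shifted label is still in the box: for
`i < j` the shift raises the maximal entry among the first `j`, which is `m_j`, and for `i = j` it
is the identity. -/
theorem sum_labelBox_shift {q : ℝ} (hq : q ≠ 0) (f : (ℕ → ℝ) → ℝ) {k j : ℕ} (hj : j ≤ k)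
    (i M : ℕ) :
    ∑ m ∈ labelBox k j M, q ^ (2 * i) * (tailWeight q j i m - tailWeight q j (i + 1) m) *
        f (fun s => if i < s then (q ^ 2)⁻¹ * tailWeight q j s m else tailWeight q j s m) =
      ∑ m ∈ labelBox k j M, if i < j → coord m j < M then
        q ^ (2 * i) * (tailWeight q j i m - q ^ 2 * tailWeight q j (i + 1) m) *
          f (fun s => tailWeight q j s m) else 0 := by
  classical
  rcases lt_or_ge j i with hi | hi
  · have h0 : ∀ m : Fin k → ℕ, tailWeight q j i m = 0 ∧ tailWeight q j (i + 1) m = 0 :=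
      fun m => ⟨if_neg (by omega), if_neg (by omega)⟩
    simp [h0]
  rw [← Finset.sum_filter]
  -- `V` is the set of labels whose shift stays in the box.
  set V := {m ∈ labelBox k j M | i < j → coord m j < M} with hV
  have hsub : V.image (raise j i) ⊆ labelBox k j M := by
    intro m' hm'
    obtain ⟨m, hm, rfl⟩ := Finset.mem_image.1 hm'
    rw [hV, Finset.mem_filter, mem_labelBox] at hm
    obtain ⟨⟨h1, h2⟩, h3⟩ := hm
    refine mem_labelBox.2 ⟨fun s => ?_, raise_admissible hj i h2⟩
    rw [coord_raise hj]
    split_ifs with h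
    · exact (h2.coord_mono h.2 le_rfl).trans_lt (h3 (by omega))
    · exact h1 s
  rw [← Finset.sum_subset hsub, Finset.sum_image (raise_injective j i).injOn]
  · refine Finset.sum_congr rfl fun m _ => ?_
    simp only [tailWeight_raise hq hj]
    congr 3
    · simp only [tailWeight, coord_raise hj, lt_irrefl, false_and, if_false]
    simp only [tailWeight, coord_raise hj]
    by_cases h : i + 1 ≤ j
    · rw [if_pos h, if_pos h, if_pos (by omega)]
      ring
    · rw [if_neg h, if_neg h, mul_zero]
  · intro m hm hm'
    obtain ⟨h1, h2⟩ := mem_labelBox.1 hm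
    have hex : ¬ ∃ m', raiseLabel hj i m' = ⟨m, h2⟩ := by
      rintro ⟨m', h⟩
      replace h : raise j i m'.1 = m := congrArg Subtype.val h
      refine hm' (Finset.mem_image.2 ⟨m'.1, ?_, h⟩)
      have hc := coord_raise hj i m'.1
      rw [h] at hc
      rw [hV, Finset.mem_filter, mem_labelBox]
      refine ⟨⟨fun s => ?_, m'.2⟩, fun hij => ?_⟩
      · have := h1 s
        rw [hc] at this
        split_ifs at this <;> omega
      · have := h1 j
        rw [hc, if_pos ⟨hij, le_rfl⟩] at this
        omega
    rw [exists_raiseLabel_iff hj hi] at hex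
    push Not at hex
    rw [tailWeight, tailWeight, if_pos hi, if_pos (by omega), le_antisymm (h2.1 i hex.1) hex.2,
      sub_self, mul_zero, zero_mul]

/-- With `y_i = q^{2i} x_i` the shifted terms are `(y_i - y_{i+1}) f`. Away from the boundary they
telescope to `y_0 - y_{n+1} = 1`; on `m_j = M` only the indices `i ≥ j` survive and give `y_j =
q^{2j+2M}`. -/
theorem sum_labelBox_traceEigen_succ {q : ℝ} (hq : q ≠ 0) {n k j : ℕ} (hj : j ≤ k) (hk : k ≤ n)
    (N M : ℕ) :
    ∑ m ∈ labelBox k j M, traceEigen q n (N + 1) (fun s => tailWeight q j s m) =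
      ∑ m ∈ labelBox k j M, traceEigen q n N (fun s => tailWeight q j s m) -
        ∑ m ∈ labelBox k j M with 0 < j ∧ coord m j = M,
          (1 - q ^ (2 * j + 2 * M)) * traceEigen q n N (fun s => tailWeight q j s m) := by
  simp only [traceEigen]
  rw [Finset.sum_comm, Finset.sum_congr rfl fun i _ => sum_labelBox_shift hq _ hj i M,
    Finset.sum_comm, Finset.sum_filter, ← Finset.sum_sub_distrib]
  refine Finset.sum_congr rfl fun m hm => ?_
  set y : ℕ → ℝ := fun i => q ^ (2 * i) * tailWeight q j i m with hy
  have hterm : ∀ i, q ^ (2 * i) * (tailWeight q j i m - q ^ 2 * tailWeight q j (i + 1) m) =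
      y i - y (i + 1) := fun i => by simp only [hy]; ring
  have hend : y (n + 1) = 0 := by
    simp only [hy, tailWeight]
    rw [if_neg (by omega), mul_zero]
  simp only [hterm]
  have hle := (mem_labelBox.1 hm).1 j
  by_cases h : 0 < j ∧ coord m j = M
  · have hyj : y j = q ^ (2 * j + 2 * M) := by
      simp only [hy, tailWeight]
      rw [if_pos le_rfl, h.2, ← pow_add]
    rw [if_pos h, ← Finset.sum_filter, ← Finset.sum_mul,
      show Finset.filter (fun i => i < j → coord m j < M) (Finset.range (n + 1)) =
        Finset.Ico j (n + 1) from ?_]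
    · have := Finset.sum_Ico_sub y (show j ≤ n + 1 by omega)
      have h2 : ∑ i ∈ Finset.Ico j (n + 1), (y i - y (i + 1)) = y j - y (n + 1) := by
        rw [← neg_sub (y (n + 1)), ← this, ← Finset.sum_neg_distrib]
        simp
      rw [h2, hend, hyj]
      ring
    · ext i
      simp only [Finset.mem_filter, Finset.mem_range, Finset.mem_Ico, h.2, lt_irrefl]
      rw [imp_false, not_lt, and_comm]
  · have h' : ∀ i, i < j → coord m j < M := fun i hi =>
      lt_of_le_of_ne hle fun he => h ⟨by omega, he⟩
    rw [if_neg h, sub_zero]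
    simp only [if_pos (h' _)]
    rw [← Finset.sum_mul, Finset.sum_range_sub', hend]
    simp [hy, tailWeight, coord]

/-! ### The boundary of the box: deleting the entry at the peak. -/

theorem coord_insertNth {k j : ℕ} (hj : j < k + 1) (M : ℕ) (m : Fin k → ℕ) (s : ℕ) :
    coord ((⟨j, hj⟩ : Fin (k + 1)).insertNth M m : Fin (k + 1) → ℕ) s =
      if s ≤ j then coord m s else if s = j + 1 then M else coord m (s - 1) := by
  cases s with
  | zero => simp [coord]
  | succ t =>
    by_cases ht : t < k + 1
    · rw [coord, dif_pos ht]
      rcases lt_trichotomy t j with h | rfl | h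
      · have : (⟨t, ht⟩ : Fin (k + 1)) = (⟨j, hj⟩ : Fin (k + 1)).succAbove ⟨t, by omega⟩ := by
          rw [Fin.succAbove_of_castSucc_lt _ _ (by simpa [Fin.lt_def] using h)]
          rfl
        rw [this, Fin.insertNth_apply_succAbove, if_pos (by omega), coord, dif_pos (by omega)]
      · simp
      · obtain ⟨u, rfl⟩ : ∃ u, t = u + 1 := ⟨t - 1, by omega⟩
        have : (⟨u + 1, ht⟩ : Fin (k + 1)) =
            (⟨j, hj⟩ : Fin (k + 1)).succAbove ⟨u, by omega⟩ := by
          rw [Fin.succAbove_of_le_castSucc _ _ (by simp [Fin.le_def]; omega)]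
          rfl
        rw [this, Fin.insertNth_apply_succAbove, if_neg (by omega), if_neg (by omega)]
        simp [coord, show u < k by omega]
    · rw [coord_of_lt _ (by omega), if_neg (by omega), if_neg (by omega), coord_of_lt m (by omega)]

theorem insertNth_mem_labelBox_iff {k j : ℕ} (hj : j < k + 1) (M : ℕ) (m : Fin k → ℕ) :
    ((⟨j, hj⟩ : Fin (k + 1)).insertNth M m : Fin (k + 1) → ℕ) ∈ labelBox (k + 1) (j + 1) M ↔
      m ∈ labelBox k j M := by
  simp only [mem_labelBox, Admissible, coord_insertNth]
  constructor
  · rintro ⟨h1, h2, h3⟩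
    have hle : ∀ s, coord m s ≤ M := fun s => by
      rcases le_or_gt s j with hs | hs
      · simpa [hs] using h1 s
      · have := h1 (s + 1)
        rwa [if_neg (by omega), if_neg (by omega), Nat.add_sub_cancel] at this
    refine ⟨hle, fun i hi => ?_, fun i hi hi' => ?_⟩
    · have := h2 i (by omega)
      rwa [if_pos (by omega), if_pos (by omega)] at this
    · have := h3 (i + 1) (by omega) (by omega)
      rwa [if_neg (by omega), if_neg (by omega), if_neg (by omega), if_neg (by omega),
        Nat.add_sub_cancel, Nat.add_sub_cancel] at this
  · rintro ⟨h1, h2, h3⟩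
    refine ⟨fun s => ?_, fun i hi => ?_, fun i hi hi' => ?_⟩
    · split_ifs
      · exact h1 s
      · exact le_rfl
      · exact h1 _
    · rcases Nat.lt_succ_iff_lt_or_eq.1 hi with hi | rfl
      · rw [if_pos (by omega), if_pos (by omega)]
        exact h2 i hi
      · rw [if_pos le_rfl, if_neg (by omega), if_pos rfl]
        exact h1 i
    · obtain ⟨t, rfl⟩ : ∃ t, i = t + 1 := ⟨i - 1, by omega⟩
      rw [if_neg (by omega), if_neg (by omega), if_neg (by omega), if_neg (by omega),
        Nat.add_sub_cancel, Nat.add_sub_cancel]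
      exact h3 t (by omega) (by omega)

/-- An entry equal to the bound `M` at place `j + 1` satisfies every inequality to its left
automatically, and none is imposed between places `j + 1` and `j + 2`. So it can be deleted and
inserted freely. -/
theorem sum_labelBox_boundary {k j : ℕ} (hj : j < k + 1) (M : ℕ) (F : (Fin (k + 1) → ℕ) → ℝ) :
    ∑ m ∈ labelBox (k + 1) (j + 1) M with 0 < j + 1 ∧ coord m (j + 1) = M, F m =
      ∑ m ∈ labelBox k j M, F ((⟨j, hj⟩ : Fin (k + 1)).insertNth M m) := by
  symm
  refine Finset.sum_bij (fun m _ => (⟨j, hj⟩ : Fin (k + 1)).insertNth M m) (fun m hm => ?_)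
    (fun a _ b _ h => ?_) (fun m hm => ?_) fun _ _ => rfl
  · rw [Finset.mem_filter, insertNth_mem_labelBox_iff, coord_insertNth]
    exact ⟨hm, by omega, by simp⟩
  · exact (Fin.insertNth_injective2 h).2
  · obtain ⟨hm, -, hM⟩ := Finset.mem_filter.1 hm
    have hM' : m ⟨j, hj⟩ = M := by simpa [coord, hj] using hM
    have h : (⟨j, hj⟩ : Fin (k + 1)).insertNth M ((⟨j, hj⟩ : Fin (k + 1)).removeNth m) = m := by
      rw [← hM']
      exact Fin.insertNth_self_removeNth _ _
    refine ⟨(⟨j, hj⟩ : Fin (k + 1)).removeNth m, ?_, h⟩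
    rw [← insertNth_mem_labelBox_iff hj, h]
    exact hm

theorem tailWeight_insertNth (q : ℝ) {k j : ℕ} (hj : j < k + 1) (M : ℕ) (m : Fin k → ℕ) :
    Function.update (fun s => tailWeight q (j + 1) s
      ((⟨j, hj⟩ : Fin (k + 1)).insertNth M m : Fin (k + 1) → ℕ)) (j + 1) 0 =
        fun s => tailWeight q j s m := by
  rw [update_tailWeight]
  ext s
  rw [tailWeight, tailWeight, coord_insertNth]
  split_ifs <;> rfl

/-- Per label, replacing `x_{j+1} = q^{2M}` by `0` and dropping the factor `1 - q^{2(j+1)+2M}` each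
cost at most `C q^{2M}`, while there are at most `(M + 1)^k` labels. -/
theorem tendsto_boundary {q : ℝ} (hq : q ∈ Set.Ioo (0 : ℝ) 1) {f : (ℕ → ℝ) → ℝ}
    (hf : LipschitzAtZero f) {k j : ℕ} (hj : j < k + 1) :
    Filter.Tendsto (fun M => (∑ m ∈ labelBox (k + 1) (j + 1) M with
        0 < j + 1 ∧ coord m (j + 1) = M,
          (1 - q ^ (2 * (j + 1) + 2 * M)) * f (fun s => tailWeight q (j + 1) s m)) -
      ∑ m ∈ labelBox k j M, f (fun s => tailWeight q j s m)) Filter.atTop (nhds 0) := by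
  obtain ⟨C, hC⟩ := hf 1
  have hC0 : 0 ≤ C := (abs_nonneg _).trans (hC (fun _ => 0) (by simp)).1
  -- The majorant is written in terms of `M + 1` so that a standard limit, shifted by one, applies;
  -- the factor `(q ^ 2)⁻¹` corrects the exponent.
  have hlim : Filter.Tendsto (fun M : ℕ => ((M + 1 : ℕ) : ℝ) ^ k * (q ^ 2) ^ (M + 1) *
      ((q ^ 2)⁻¹ * (2 * C))) Filter.atTop (nhds 0) := by
    have h := (Filter.tendsto_add_atTop_iff_nat 1).2
      (tendsto_pow_const_mul_const_pow_of_abs_lt_one k (r := q ^ 2) (by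
        rw [abs_of_nonneg (sq_nonneg q)]
        exact pow_lt_one₀ hq.1.le hq.2 two_ne_zero))
    simpa using h.mul_const ((q ^ 2)⁻¹ * (2 * C))
  refine squeeze_zero_norm (fun M => ?_) hlim
  rw [sum_labelBox_boundary hj, ← Finset.sum_sub_distrib]
  have hterm : ∀ m ∈ labelBox k j M, ‖(1 - q ^ (2 * (j + 1) + 2 * M)) *
      f (fun s => tailWeight q (j + 1) s
        ((⟨j, hj⟩ : Fin (k + 1)).insertNth M m : Fin (k + 1) → ℕ)) -
      f (fun s => tailWeight q j s m)‖ ≤ 2 * C * q ^ (2 * M) := by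
    intro m _
    set x : ℕ → ℝ := fun s => tailWeight q (j + 1) s
        ((⟨j, hj⟩ : Fin (k + 1)).insertNth M m : Fin (k + 1) → ℕ) with hx
    have hxj : |x (j + 1)| = q ^ (2 * M) := by
      simp only [hx, tailWeight, coord_insertNth]
      rw [if_pos le_rfl, if_neg (by omega), if_pos trivial, abs_of_nonneg (pow_nonneg hq.1.le _)]
    obtain ⟨h1, h2⟩ := hC x fun s => abs_tailWeight_le hq _ s _
    have h3 := h2 (j + 1)
    rw [tailWeight_insertNth, hxj] at h3
    have hp : 0 ≤ q ^ (2 * M) := pow_nonneg hq.1.le _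
    have hp' : q ^ (2 * (j + 1) + 2 * M) ≤ q ^ (2 * M) :=
      pow_le_pow_of_le_one hq.1.le hq.2.le (by omega)
    have hp'' : 0 ≤ q ^ (2 * (j + 1) + 2 * M) := pow_nonneg hq.1.le _
    calc ‖(1 - q ^ (2 * (j + 1) + 2 * M)) * f x - f (fun s => tailWeight q j s m)‖
        = |(f x - f (fun s => tailWeight q j s m)) - q ^ (2 * (j + 1) + 2 * M) * f x| := by
          rw [Real.norm_eq_abs]; congr 1; ring
      _ ≤ |f x - f (fun s => tailWeight q j s m)| + q ^ (2 * (j + 1) + 2 * M) * |f x| := by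
          rw [← abs_of_nonneg hp'', ← abs_mul, abs_of_nonneg hp'']; exact abs_sub _ _
      _ ≤ C * q ^ (2 * M) + q ^ (2 * M) * C :=
          add_le_add h3 (mul_le_mul hp' h1 (abs_nonneg _) hp)
      _ = 2 * C * q ^ (2 * M) := by ring
  refine (norm_sum_le_of_le _ hterm).trans ?_
  have hq2 : q ^ 2 ≠ 0 := pow_ne_zero _ hq.1.ne'
  rw [Finset.sum_const, nsmul_eq_mul]
  calc ((labelBox k j M).card : ℝ) * (2 * C * q ^ (2 * M))
      ≤ ((M + 1 : ℕ) : ℝ) ^ k * (2 * C * q ^ (2 * M)) :=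
        mul_le_mul_of_nonneg_right (by exact_mod_cast card_labelBox_le k j M)
          (mul_nonneg (by positivity) (pow_nonneg hq.1.le _))
    _ = ((M + 1 : ℕ) : ℝ) ^ k * (q ^ 2) ^ (M + 1) * ((q ^ 2)⁻¹ * (2 * C)) := by
        rw [pow_succ (q ^ 2), ← pow_mul]
        have := mul_inv_cancel₀ hq2
        linear_combination (-(((M + 1 : ℕ) : ℝ) ^ k * (2 * C * q ^ (2 * M)))) * this

theorem tendsto_sum_box_pairingEigen {q : ℝ} (hq : q ∈ Set.Ioo (0 : ℝ) 1) {n k : ℕ}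
    (hk : k ≤ n) (N : ℕ) :
    Filter.Tendsto (fun M => ∑ m ∈ box k M, pairingEigen q (traceEigen q n N) m)
      Filter.atTop (nhds (N.choose k : ℝ)) := by
  induction N generalizing k with
  | zero =>
    refine tendsto_const_nhds.congr fun M => ?_
    cases k with
    | zero =>
      have : ∀ m : Fin 0 → ℕ, Admissible 0 m := fun m => ⟨by simp, by simp⟩
      simp [pairingEigen, traceEigen, box, this]
    | succ k =>
      rw [Finset.sum_eq_zero fun m _ => ?_]
      · simp
      · rcases pairingEigen_eq q (traceEigen q n 0) k.succ_pos m with h | ⟨b, -, -, h⟩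
        · exact h
        -- For `N = 0` the eigenvalue is constant, so the two contributions at a peak cancel
        -- exactly.
        · rw [h]; simp [traceEigen]
  | succ N ih =>
    have hrec : ∀ M, ∑ m ∈ box k M, pairingEigen q (traceEigen q n (N + 1)) m =
        ∑ m ∈ box k M, pairingEigen q (traceEigen q n N) m -
          ∑ j ∈ Finset.range (k + 1), (-1) ^ j *
            ∑ m ∈ labelBox k j M with 0 < j ∧ coord m j = M,
              (1 - q ^ (2 * j + 2 * M)) * traceEigen q n N (fun s => tailWeight q j s m) := by
      intro M
      rw [sum_box_pairingEigen, sum_box_pairingEigen, ← Finset.sum_sub_distrib]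
      refine Finset.sum_congr rfl fun j hj => ?_
      rw [sum_labelBox_traceEigen_succ hq.1.ne' (by simpa [Nat.lt_succ_iff] using hj) hk,
        mul_sub]
    simp only [hrec]
    cases k with
    -- For `k = 0` only `j = 0` occurs and there is no boundary, so the truncated sum does not
    -- depend on `N`.
    | zero => simpa using ih hk
    | succ k =>
      have hb := tendsto_finsetSum (Finset.range (k + 1)) fun j hj =>
        (tendsto_boundary hq (lipschitzAtZero_traceEigen q n N)
          (Finset.mem_range.1 hj)).const_mul ((-1 : ℝ) ^ j)
      have h := ((ih hk).add (ih (Nat.le_of_succ_le hk))).add hb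
      rw [Nat.choose_succ_succ, Nat.cast_add, add_comm (N.choose k : ℝ)]
      simp only [mul_zero, Finset.sum_const_zero, add_zero] at h
      refine h.congr fun M => ?_
      -- The term `j = 0` has no boundary. Shifting `j` to `j + 1` in the others flips the sign, so
      -- that the subtracted boundary becomes the added truncated trace for `k`.
      rw [sum_box_pairingEigen q _ k M, Finset.sum_range_succ' _ (k + 1)]
      simp only [lt_irrefl, false_and, Finset.filter_false, Finset.sum_empty, mul_zero, add_zero,
        mul_sub, Finset.sum_sub_distrib, pow_succ (-1 : ℝ), mul_neg_one, neg_mul,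
        Finset.sum_neg_distrib]
      ring

end QuantumProjective

end

theorem mainTheorem2 (q : ℝ) (hq : q ∈ Set.Ioo (0 : ℝ) 1) (n k : ℕ) (hk : k ≤ n) (N : ℕ) :
    QuantumProjective.HasIndexPairing hq hk (QuantumProjective.projNeg hq n N)
      ((N.choose k : ℕ) : ℂ) := by
  open QuantumProjective in
  have hs := summable_abs_pairingEigen hq (lipschitzAtZero_traceEigen q n N) k
  have hsum : ∑' m : Fin k → ℕ, pairingEigen q (traceEigen q n N) m = N.choose k :=
    -- Absolute summability allows the trace to be computed along the exhausting boxes.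
    tendsto_nhds_unique (hs.of_abs.hasSum.comp (tendsto_box k))
      (tendsto_sum_box_pairingEigen hq hk N)
  refine ⟨isStarProjection_projNeg hq n N, ?_⟩
  have h := hasTrace_diagonal (pairingOperator_apply hq hk N) hs
  rw [hsum] at h
  exact_mod_cast h
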